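/- All graphs are finite and simple. A perfect matching of $G$ is a set of pairwise disjoint edges covering every vertex. A graph $G$ is matching covered if it is connected and every edge of $G$ lies in a perfect matching of $G$. For $S\subseteq V(G)$, let $\partial(S)$ be the set of edges of $G$ with exactly one endpoint in $S$; this cut is tight if $|M\cap\partial(S)|=1$ for every perfect matching $M$ of $G$, and trivial if $S$ or $V(G)\setminus S$ has exactly one vertex. A brace is a bipartite matching covered graph in which every tight cut is trivial. The matching porosity of $\partial(S)$ is the maximum of $|M\cap\partial(S)|$ over all perfect matchings $M$ of $G$. A perfect matching decomposition of $G$ is a pair $(T,\delta)$, where $T$ is a finite tree all of whose vertices have degree $1$ or $3$, and $\delta$ is a bijection from the leaves (the vertices of degree $1$) of $T$ to $V(G)$. Deleting an edge $t_1t_2$ of $T$ splits $T$ into two subtrees and so, through $\delta$, partitions $V(G)$ into two sets $X_1,X_2$; let $\partial(t_1t_2)=\partial(X_1)=\partial(X_2)$. The width of $(T,\delta)$ is the maximum, over all edges $t_1t_2$ of $T$, of the matching porosity of $\partial(t_1t_2)$, and the perfect matching width $\mathrm{pmw}(G)$ is the minimum width of a perfect matching decomposition of $G$. Let $G=(A\cup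 B,E)$ be bipartite with colour classes $A$ and $B$. For a linear ordering $\lambda$ of $A$ and $a\in A$, let $\mathrm{Pred}_\lambda(a)=\{a'\in A:\lambda(a')\le\lambda(a)\}$, and let $N(\mathrm{Pred}_\lambda(a))$ be the set of vertices with a neighbour in $\mathrm{Pred}_\lambda(a)$. The matching elimination width of $G$ (with respect to $A$) is $$\min_{\lambda}\ \max_{a\in A}\ \bigl(|N(\mathrm{Pred}_\lambda(a))|-|\mathrm{Pred}_\lambda(a)|\bigr),$$ where $\lambda$ ranges over all linear orderings of $A$. **Proposition.** Let $G=(A\cup B,E)$ be a brace on at least $6$ vertices. Then $\mathrm{pmw}(G)=2$ if and only if the matching elimination width of $G$ with respect to $A$ is $2$. -/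

import Mathlib

namespace PMWidth

universe u

variable {V : Type u}

/-- The cut `∂(S)`: all edges of `G` joining a vertex of `S` to a vertex outside `S`. -/
def cut (G : SimpleGraph V) (S : Set V) : Set (Sym2 V) :=
  {e | e ∈ G.edgeSet ∧ ∃ x ∈ S, ∃ y ∉ S, e = s(x, y)}

/-- `G` is connected and every edge of `G` lies in a perfect matching. -/
def IsMatchingCovered (G : SimpleGraph V) : Prop :=
  G.Connected ∧ ∀ e ∈ G.edgeSet, ∃ M : G.Subgraph, M.IsPerfectMatching ∧ e ∈ M.edgeSet

/-- The cut at `Z` is tight: every perfect matching meets it in exactly one edge. -/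
def IsTightCut (G : SimpleGraph V) (Z : Set V) : Prop :=
  ∀ M : G.Subgraph, M.IsPerfectMatching → (M.edgeSet ∩ cut G Z).ncard = 1

/-- The cut at `Z` is trivial: one of its two shores has exactly one vertex. -/
def IsTrivialCut (Z : Set V) : Prop :=
  Z.ncard = 1 ∨ Zᶜ.ncard = 1

/-- A brace: a bipartite matching covered graph all of whose tight cuts are trivial. -/
def IsBrace (G : SimpleGraph V) : Prop :=
  G.IsBipartite ∧ IsMatchingCovered G ∧ ∀ Z : Set V, IsTightCut G Z → IsTrivialCut Z

/-- The matching porosity of the cut at `S` (for finite `G`): the maximum number of edges of the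
cut in a perfect matching of `G`. -/
noncomputable def porosity (G : SimpleGraph V) (S : Set V) : ℕ :=
  sSup {k | ∃ M : G.Subgraph, M.IsPerfectMatching ∧ k = (M.edgeSet ∩ cut G S).ncard}

/-- The leaves of a tree: its vertices of degree one. -/
def leaves {N : Type} (T : SimpleGraph N) : Set N :=
  {t | (T.neighborSet t).ncard = 1}

/-- A perfect matching decomposition of a graph on `V`: a finite cubic tree (every vertex
is a leaf or has degree three) with a bijection from its leaves to `V`. -/
structure PMDecomposition (V : Type u) where
  /-- The vertices of the tree. -/
  Node : Type
  finite_node : Finite Node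
  /-- The tree. -/
  tree : SimpleGraph Node
  isTree : tree.IsTree
  cubic : ∀ t : Node, (tree.neighborSet t).ncard = 1 ∨ (tree.neighborSet t).ncard = 3
  /-- The bijection from the leaves to the vertices of the graph. -/
  leafEquiv : leaves tree ≃ V

/-- The vertices of the graph mapped to the leaves in the component of `T - t₁t₂` that
contains `t₁`. -/
def PMDecomposition.shore (D : PMDecomposition V) (t₁ t₂ : D.Node) : Set V :=
  {v | (D.tree.deleteEdges {s(t₁, t₂)}).Reachable t₁ (D.leafEquiv.symm v)}

/-- The width of a decomposition: the maximum porosity in `G` of a cut induced by a tree edge. -/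
noncomputable def PMDecomposition.width (G : SimpleGraph V) (D : PMDecomposition V) : ℕ :=
  sSup {k | ∃ t₁ t₂ : D.Node, D.tree.Adj t₁ t₂ ∧ k = porosity G (D.shore t₁ t₂)}

/-- The perfect matching width of `G`: the minimum width of a perfect matching decomposition. -/
noncomputable def pmw (G : SimpleGraph V) : ℕ :=
  sInf {k | ∃ D : PMDecomposition V, k = D.width G}

/-- A linear ordering of a finite set `A`, given as a numbering of its elements. -/
abbrev Ordering (A : Set V) : Type u := A ≃ Fin A.ncard

/-- `Pred_lam(a)`: all elements of `A` that are at most `a` in the ordering. -/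
def pred {A : Set V} (lam : Ordering A) (a : A) : Set V :=
  {x | ∃ a' : A, lam a' ≤ lam a ∧ x = a'}

/-- The neighbourhood in `G` of the set `Pred_lam(a)`. -/
def reach (G : SimpleGraph V) {A : Set V} (lam : Ordering A) (a : A) : Set V :=
  {y | ∃ x ∈ pred lam a, G.Adj x y}

/-- The width of an ordering of the (finite, non-empty) set `A`. -/
noncomputable def orderingWidth (G : SimpleGraph V) {A : Set V} (lam : Ordering A) : ℤ :=
  ⨆ a : A, (((reach G lam a).ncard : ℤ) - ((pred lam a).ncard : ℤ))

/-- The matching elimination width of `G` with respect to the (finite, non-empty) set `A`. -/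
noncomputable def matchingEliminationWidth (G : SimpleGraph V) (A : Set V) : ℤ :=
  ⨅ lam : Ordering A, orderingWidth G lam

end PMWidth

/-!
Write `n = |A| = |B|`. A perfect matching is handled as the involution `f` sending each vertex to its
partner; it meets the cut at `X` in as many edges as there are `v ∈ X` with `f v ∉ X`. Counting these
by colour (`crossing_count`) shows that a perfect matching crosses the cut at `X` with `p` edges
starting in `A ∩ X` and `q` edges starting in `B ∩ X`, where `p - q = |A ∩ X| - |B ∩ X|`. In a brace
every non-empty `S ⊆ A` with `|S| ≤ n - 2` has at least `|S| + 2` neighbours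
(`card_add_two_le_nbhd`), and hence, by Hall's theorem, any two disjoint edges lie in a common perfect
matching (`exists_map_of_two_edges`). It follows that both widths are at least two.

Let a decomposition of width two be given. A shore with an odd number of vertices gives a tight cut,
so it is trivial. An even shore has imbalance `|A ∩ X| - |B ∩ X|` equal to `0`, `2` or `-2`. If the
imbalance is `0`, then two-extendability forces `X` or its complement to have at most one vertex of
each colour (`balanced_small`). If it is `-2`, then all neighbours of `A ∩ X` lie in `B ∩ X`
(`nbhd_subset_of_imbalance`), so `|N(A ∩ X)| ≤ |A ∩ X| + 2`. Therefore a shore of imbalance `-2` with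
more than two vertices splits at its tree node into a pair of one vertex of each colour and a smaller
shore of imbalance `-2`: the tree is a caterpillar. Following its spine from one end to the other adds
the vertices of `A` one at a time, which gives the elimination ordering (`chain_of_shore`,
`exists_ordering_of_width_le_two`). For `n = 3` there may be no unbalanced shore, but then every
ordering will do.

Conversely, let `a₁, …, aₙ` be an elimination ordering of width two. Number `B` as `b₁, …, bₙ` by
first neighbours, so that all neighbours of `a₁, …, aᵢ` are among `b₁, …, bᵢ₊₂`. The cubic caterpillar
whose legs carry the pairs `{b₁, b₂}, {a₁, b₃}, …, {aₙ₋₂, bₙ}, {aₙ₋₁, aₙ}` has width two: on an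
initial segment of these pairs no crossing edge starts in `A`, so that the number of crossing edges
is its imbalance (`exists_width_le_two_of_numberings`).
-/

/-! ### Matching maps, crossing numbers and expansion in braces -/

namespace PMWidth

variable {V : Type*}

/-- A perfect matching of `G` encoded by the map sending each vertex to its partner. -/
def IsMatchingMap (G : SimpleGraph V) (f : V → V) : Prop :=
  Function.Involutive f ∧ ∀ v, G.Adj v (f v)

/-- The vertices of `S` that are matched outside `S` by the matching map `f`. -/
def crossing (f : V → V) (S : Set V) : Set V := {v | v ∈ S ∧ f v ∉ S}

/-- The union of the neighbourhoods of the vertices of `S`. -/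
def nbhd (G : SimpleGraph V) (S : Set V) : Set V := {y | ∃ x ∈ S, G.Adj x y}

lemma exists_matchingMap {G : SimpleGraph V} {M : G.Subgraph} (hM : M.IsPerfectMatching) :
    ∃ f, IsMatchingMap G f ∧ ∀ v w, M.Adj v w ↔ f v = w := by
  rw [SimpleGraph.Subgraph.isPerfectMatching_iff] at hM
  choose f hf hu using hM
  refine ⟨f, ⟨fun v => (hu (f v) v (hf v).symm).symm, fun v => (hf v).adj_sub⟩, fun v w => ?_⟩
  exact ⟨fun h => (hu v w h).symm, fun h => h ▸ hf v⟩

lemma exists_subgraph {G : SimpleGraph V} {f : V → V} (hf : IsMatchingMap G f) :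
    ∃ M : G.Subgraph, M.IsPerfectMatching ∧ ∀ v w, M.Adj v w ↔ f v = w := by
  refine ⟨⟨Set.univ, fun v w => f v = w, fun h => h ▸ hf.2 _, fun _ => trivial,
    ⟨fun v w h => by subst h; exact hf.1 v⟩⟩, ?_, fun v w => Iff.rfl⟩
  rw [SimpleGraph.Subgraph.isPerfectMatching_iff]
  exact fun v => ⟨f v, rfl, fun y (h : f v = y) => h.symm⟩

lemma ncard_inter_cut {G : SimpleGraph V} {f : V → V} (hf : IsMatchingMap G f) {M : G.Subgraph}
    (h : ∀ v w, M.Adj v w ↔ f v = w) (S : Set V) :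
    (M.edgeSet ∩ cut G S).ncard = (crossing f S).ncard := by
  have : M.edgeSet ∩ cut G S = (fun v => s(v, f v)) '' crossing f S := by
    ext e
    constructor
    · rintro ⟨h1, h2, x, hx, y, hy, rfl⟩
      have : f x = y := (h x y).1 h1
      subst this
      exact ⟨x, ⟨hx, hy⟩, rfl⟩
    · rintro ⟨x, ⟨hx, hy⟩, rfl⟩
      exact ⟨(h _ _).2 rfl, hf.2 x, x, hx, _, hy, rfl⟩
  rw [this, Set.InjOn.ncard_image]
  rintro x ⟨hx, hx'⟩ y ⟨hy, hy'⟩ hxy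
  simp only [Sym2.eq_iff] at hxy
  rcases hxy with h | h
  · exact h.1
  · exact absurd (h.1 ▸ hx) hy'

lemma porosity_le_iff [Finite V] {G : SimpleGraph V} {S : Set V} {k : ℕ} :
    porosity G S ≤ k ↔ ∀ f, IsMatchingMap G f → (crossing f S).ncard ≤ k := by
  constructor
  · intro h f hf
    obtain ⟨M, hM, hMf⟩ := exists_subgraph hf
    rw [← ncard_inter_cut hf hMf]
    have hbdd : BddAbove {k | ∃ M : G.Subgraph, M.IsPerfectMatching ∧
        k = (M.edgeSet ∩ cut G S).ncard} := by
      refine ⟨Nat.card (Sym2 V), ?_⟩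
      rintro _ ⟨M, -, rfl⟩
      rw [← Set.ncard_univ]
      exact Set.ncard_le_ncard (Set.subset_univ _)
    exact (le_csSup hbdd ⟨M, hM, rfl⟩).trans h
  · intro h
    refine csSup_le' ?_
    rintro _ ⟨M, hM, rfl⟩
    obtain ⟨f, hf, hMf⟩ := exists_matchingMap hM
    rw [ncard_inter_cut hf hMf]
    exact h f hf

lemma isTightCut_of_crossing {G : SimpleGraph V} {S : Set V}
    (h : ∀ f, IsMatchingMap G f → (crossing f S).ncard = 1) : IsTightCut G S := by
  intro M hM
  obtain ⟨f, hf, hMf⟩ := exists_matchingMap hM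
  rw [ncard_inter_cut hf hMf]
  exact h f hf

lemma cut_compl (G : SimpleGraph V) (S : Set V) : cut G Sᶜ = cut G S := by
  ext e
  constructor <;> rintro ⟨h, x, hx, y, hy, rfl⟩
  · exact ⟨h, y, by simpa using hy, x, hx, Sym2.eq_swap⟩
  · exact ⟨h, y, by simpa using hy, x, by simpa using hx, Sym2.eq_swap⟩

lemma porosity_compl (G : SimpleGraph V) (S : Set V) : porosity G Sᶜ = porosity G S := by
  simp only [porosity, cut_compl]

lemma IsMatchingCovered.exists_map {G : SimpleGraph V} (hG : IsMatchingCovered G) {u v : V}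
    (h : G.Adj u v) : ∃ f, IsMatchingMap G f ∧ f u = v := by
  obtain ⟨M, hM, he⟩ := hG.2 s(u, v) h
  obtain ⟨f, hf, hMf⟩ := exists_matchingMap hM
  exact ⟨f, hf, (hMf _ _).1 he⟩

/-- A connected graph has an edge leaving every proper non-empty vertex set. -/
lemma exists_adj_leaving {G : SimpleGraph V} (hG : G.Connected) {S : Set V} (h1 : S.Nonempty)
    (h2 : Sᶜ.Nonempty) : ∃ u ∈ S, ∃ v ∉ S, G.Adj u v := by
  obtain ⟨x, hx⟩ := h1
  obtain ⟨y, hy⟩ := h2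
  obtain ⟨p⟩ := hG.preconnected x y
  obtain ⟨d, -, h3, h4⟩ := p.exists_boundary_dart S hx hy
  exact ⟨_, h3, _, h4, d.adj⟩

section Bipartite

variable {G : SimpleGraph V} {A B : Set V}

lemma mem_right_of_map (hAB : G.IsBipartiteWith A B) {f : V → V} (hf : IsMatchingMap G f) {v : V}
    (hv : v ∈ A) : f v ∈ B := by
  rcases hAB.mem_of_adj (hf.2 v) with h | h
  · exact h.2
  · exact absurd h.1 (Set.disjoint_left.1 hAB.disjoint hv)

lemma nbhd_subset (hAB : G.IsBipartiteWith A B) {S : Set V} (hS : S ⊆ A) : nbhd G S ⊆ B := by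
  rintro y ⟨x, hx, h⟩
  exact hAB.mem_of_mem_adj (hS hx) h

variable [Finite V]

lemma ncard_colour_split (hAB : G.IsBipartiteWith A B) (hcover : A ∪ B = Set.univ) (X : Set V) :
    X.ncard = (A ∩ X).ncard + (B ∩ X).ncard := by
  rw [← Set.ncard_union_eq (hAB.disjoint.mono Set.inter_subset_left Set.inter_subset_left),
    ← Set.union_inter_distrib_right, hcover, Set.univ_inter]

/-- Each matching map restricts to a bijection between the vertices of `A ∩ X` and of `B ∩ X` that
are matched inside `X`; counting the others relates the imbalance of `X` to the crossing edges. -/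
lemma crossing_count (hAB : G.IsBipartiteWith A B) (hcover : A ∪ B = Set.univ) {f : V → V}
    (hf : IsMatchingMap G f) (X : Set V) :
    (crossing f X).ncard = (A ∩ crossing f X).ncard + (B ∩ crossing f X).ncard ∧
    (A ∩ X).ncard + (B ∩ crossing f X).ncard = (B ∩ X).ncard + (A ∩ crossing f X).ncard := by
  refine ⟨ncard_colour_split hAB hcover _, ?_⟩
  have key : ∀ C : Set V, (C ∩ X).ncard = (C ∩ crossing f X).ncard
      + {v | v ∈ C ∧ v ∈ X ∧ f v ∈ X}.ncard := by
    intro C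
    rw [← Set.ncard_union_eq]
    · congr 1
      ext v
      simp only [crossing, Set.mem_inter_iff, Set.mem_union, Set.mem_ofPred_eq]
      tauto
    · rw [Set.disjoint_left]
      rintro v ⟨-, -, h⟩ ⟨-, -, h'⟩
      exact h h'
  have himg : f '' {v | v ∈ A ∧ v ∈ X ∧ f v ∈ X} = {v | v ∈ B ∧ v ∈ X ∧ f v ∈ X} := by
    ext w
    constructor
    · rintro ⟨v, ⟨h1, h2, h3⟩, rfl⟩
      exact ⟨mem_right_of_map hAB hf h1, h3, by rwa [hf.1 v]⟩
    · rintro ⟨h1, h2, h3⟩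
      exact ⟨f w, ⟨mem_right_of_map hAB.symm hf h1, h3, by rwa [hf.1 w]⟩, hf.1 w⟩
  have h1 := key A
  have h2 := key B
  rw [← himg, Set.ncard_image_of_injective _ hf.1.injective] at h2
  omega

lemma exists_matchingMap_of_brace (hG : IsBrace G) (hcard : 6 ≤ Nat.card V) :
    ∃ f, IsMatchingMap G f := by
  have : Nontrivial V := Finite.one_lt_card_iff_nontrivial.1 (by omega)
  obtain ⟨x⟩ := this.to_nonempty
  obtain ⟨u, -, v, -, h⟩ := exists_adj_leaving hG.2.1.1 (S := {x}) ⟨x, rfl⟩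
    (by obtain ⟨y, hy⟩ := exists_ne x; exact ⟨y, by simpa using hy⟩)
  obtain ⟨f, hf, -⟩ := hG.2.1.exists_map h
  exact ⟨f, hf⟩

lemma ncard_colours_eq (hAB : G.IsBipartiteWith A B) (hcover : A ∪ B = Set.univ)
    (hG : IsBrace G) (hcard : 6 ≤ Nat.card V) :
    A.ncard = B.ncard ∧ Nat.card V = 2 * A.ncard := by
  obtain ⟨f, hf⟩ := exists_matchingMap_of_brace hG hcard
  have h1 := ncard_colour_split hAB hcover Set.univ
  have h2 := (crossing_count hAB hcover hf Set.univ).2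
  have h3 : crossing f Set.univ = ∅ := by ext; simp [crossing]
  simp only [h3, Set.inter_univ, Set.inter_empty, Set.ncard_empty, Set.ncard_univ] at h1 h2
  omega

/-- In a brace the only subsets `S` of a colour class with `|N(S)| ≤ |S| + 1` are the obvious ones:
otherwise `S ∪ N(S)` would be one shore of a non-trivial tight cut. -/
lemma card_add_two_le_nbhd (hAB : G.IsBipartiteWith A B) (hcover : A ∪ B = Set.univ)
    (hG : IsBrace G) (hcard : 6 ≤ Nat.card V) {S : Set V} (hS : S ⊆ A) (hne : S.Nonempty)
    (hle : S.ncard + 2 ≤ A.ncard) : S.ncard + 2 ≤ (nbhd G S).ncard := by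
  have hn := ncard_colours_eq hAB hcover hG hcard
  have hN := nbhd_subset hAB hS
  set X := S ∪ nbhd G S with hX
  have hXA : A ∩ X = S := by
    ext v
    simp only [hX, Set.mem_inter_iff, Set.mem_union]
    exact ⟨fun ⟨h1, h2⟩ => h2.resolve_right
      fun h => Set.disjoint_left.1 hAB.disjoint h1 (hN h), fun h => ⟨hS h, Or.inl h⟩⟩
  have hXB : B ∩ X = nbhd G S := by
    ext v
    simp only [hX, Set.mem_inter_iff, Set.mem_union]
    exact ⟨fun ⟨h1, h2⟩ => h2.resolve_left
      fun h => Set.disjoint_left.1 hAB.disjoint (hS h) h1, fun h => ⟨hN h, Or.inr h⟩⟩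
  have hXc := ncard_colour_split hAB hcover X
  have hXcompl := Set.ncard_add_ncard_compl X
  have hSpos : 0 < S.ncard := (Set.ncard_pos).2 hne
  have hcount : ∀ f, IsMatchingMap G f →
      S.ncard + (crossing f X).ncard = (nbhd G S).ncard := by
    intro f hf
    have h0 : A ∩ crossing f X = ∅ := by
      ext v
      simp only [crossing, Set.mem_inter_iff, Set.mem_ofPred_eq, Set.mem_empty_iff_false, iff_false]
      rintro ⟨h1, h2, h3⟩
      exact h3 (Or.inr ⟨v, hXA ▸ ⟨h1, h2⟩, hf.2 v⟩)
    have := crossing_count hAB hcover hf X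
    rw [h0, hXA, hXB, Set.ncard_empty] at this
    omega
  rw [hXA, hXB] at hXc
  by_contra hlt
  obtain ⟨u, hu, v, hv, huv⟩ := exists_adj_leaving hG.2.1.1 (S := X)
    (hne.mono Set.subset_union_left) (by rw [← Set.ncard_pos]; omega)
  obtain ⟨f, hf, hfu⟩ := hG.2.1.exists_map huv
  have hpos : 0 < (crossing f X).ncard := (Set.ncard_pos).2 ⟨u, hu, hfu ▸ hv⟩
  have hf' := hcount f hf
  rcases hG.2.2 X (isTightCut_of_crossing fun g hg => by have := hcount g hg; omega) with h | h <;>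
    omega

/-- An injection from `A` to `B` along edges of `G` is a perfect matching when `|A| = |B|`. -/
lemma exists_map_of_injective (hAB : G.IsBipartiteWith A B) (hcover : A ∪ B = Set.univ)
    (hn : A.ncard = B.ncard) {g : A → V} (hg : Function.Injective g) (hadj : ∀ a : A, G.Adj a (g a)) :
    ∃ f, IsMatchingMap G f ∧ ∀ a : A, f a = g a := by
  classical
  have hgB : ∀ a, g a ∈ B := fun a => hAB.mem_of_mem_adj a.2 (hadj a)
  let g' : A → B := fun a => ⟨g a, hgB a⟩
  have hg' : Function.Bijective g' := by
    have : Fintype A := Fintype.ofFinite _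
    have : Fintype B := Fintype.ofFinite _
    rw [Fintype.bijective_iff_injective_and_card]
    refine ⟨fun x y h => hg (congrArg Subtype.val h), ?_⟩
    rw [← Nat.card_eq_fintype_card, ← Nat.card_eq_fintype_card]
    exact hn
  let e : A ≃ B := Equiv.ofBijective g' hg'
  have hB : ∀ v, v ∉ A → v ∈ B := fun v hv =>
    (show v ∈ A ∪ B from hcover ▸ trivial).resolve_left hv
  let f : V → V := fun v => if h : v ∈ A then e ⟨v, h⟩ else e.symm ⟨v, hB v h⟩
  have hfA : ∀ a : A, f a = g a := fun a => by simp [f, e, g']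
  have hfB : ∀ b : B, f b = e.symm b := fun b => by
    have : (b : V) ∉ A := fun h => Set.disjoint_left.1 hAB.disjoint h b.2
    simp [f, this]
  refine ⟨f, ⟨fun v => ?_, fun v => ?_⟩, hfA⟩
  · by_cases h : v ∈ A
    · have h1 := hfA ⟨v, h⟩
      have h2 := hfB (e ⟨v, h⟩)
      rw [Equiv.symm_apply_apply] at h2
      rw [show f v = g ⟨v, h⟩ from h1]
      exact h2
    · have h1 := hfB ⟨v, hB v h⟩
      rw [show f v = _ from h1, hfA]
      exact congrArg Subtype.val (e.apply_symm_apply ⟨v, hB v h⟩)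
  · by_cases h : v ∈ A
    · rw [show f v = g ⟨v, h⟩ from hfA ⟨v, h⟩]
      exact hadj ⟨v, h⟩
    · have h1 := hfB ⟨v, hB v h⟩
      rw [show f v = _ from h1]
      have h2 := hadj (e.symm ⟨v, hB v h⟩)
      have h3 : g (e.symm ⟨v, hB v h⟩) = v :=
        congrArg Subtype.val (e.apply_symm_apply ⟨v, hB v h⟩)
      rw [h3] at h2
      exact h2.symm

/-- Braces are 2-extendable: two disjoint edges lie in a common perfect matching. This is Hall's
theorem, since deleting two vertices of `B` leaves the Hall condition for all small subsets of
`A`. -/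
lemma exists_map_of_two_edges (hAB : G.IsBipartiteWith A B) (hcover : A ∪ B = Set.univ)
    (hG : IsBrace G) (hcard : 6 ≤ Nat.card V) {a a' b b' : V} (ha : a ∈ A) (ha' : a' ∈ A)
    (hab : G.Adj a b) (hab' : G.Adj a' b') (haa : a ≠ a') (hbb : b ≠ b') :
    ∃ f, IsMatchingMap G f ∧ f a = b ∧ f a' = b' := by
  classical
  have : Fintype V := Fintype.ofFinite V
  have hn := ncard_colours_eq hAB hcover hG hcard
  let t : {x // x ∈ A ∧ x ≠ a ∧ x ≠ a'} → Finset V :=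
    fun x => Finset.univ.filter fun y => G.Adj x y ∧ y ≠ b ∧ y ≠ b'
  have hall : ∀ s : Finset {x // x ∈ A ∧ x ≠ a ∧ x ≠ a'}, s.card ≤ (s.biUnion t).card := by
    intro s
    rcases s.eq_empty_or_nonempty with rfl | hs
    · simp
    let S : Set V := Subtype.val '' (s : Set {x // x ∈ A ∧ x ≠ a ∧ x ≠ a'})
    have hSc : S.ncard = s.card := by
      rw [Set.ncard_image_of_injective _ Subtype.val_injective, Set.ncard_coe_finset]
    have hSA : S ∪ {a, a'} ⊆ A := by
      rintro v (⟨x, -, rfl⟩ | rfl | rfl)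
      · exact x.2.1
      · exact ha
      · exact ha'
    have hdisj : Disjoint S {a, a'} := by
      rw [Set.disjoint_left]
      rintro v ⟨x, -, rfl⟩ (h | h)
      · exact x.2.2.1 h
      · exact x.2.2.2 h
    have hle := Set.ncard_le_ncard hSA
    rw [Set.ncard_union_eq hdisj, Set.ncard_pair haa] at hle
    have h2 := card_add_two_le_nbhd hAB hcover hG hcard
      (Set.subset_union_left.trans hSA) (by simpa [S] using hs) hle
    have h3 : nbhd G S ⊆ (s.biUnion t : Finset V) ∪ ({b, b'} : Set V) := by
      rintro y ⟨_, ⟨x, hx, rfl⟩, hxy⟩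
      by_cases h : y = b ∨ y = b'
      · exact Or.inr h
      · push Not at h
        left
        simp only [Finset.coe_biUnion, Set.mem_iUnion]
        exact ⟨x, hx, by simp [t, hxy, h.1, h.2]⟩
    have h4 := (Set.ncard_le_ncard h3).trans (Set.ncard_union_le _ _)
    rw [Set.ncard_coe_finset, Set.ncard_pair hbb] at h4
    omega
  obtain ⟨g, hg, hgt⟩ := (Finset.all_card_le_biUnion_card_iff_exists_injective t).1 hall
  have hgt' : ∀ x : {x // x ∈ A ∧ x ≠ a ∧ x ≠ a'}, G.Adj x (g x) ∧ g x ≠ b ∧ g x ≠ b' := fun x => by simpa [t] using hgt x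
  let g' : A → V := fun x => if h : (x : V) = a then b else if h' : (x : V) = a' then b' else
    g ⟨x, x.2, h, h'⟩
  have hinj : Function.Injective g' := by
    intro x y hxy
    apply Subtype.ext
    simp only [g'] at hxy
    split_ifs at hxy with h1 h2 h3 h4 h5 h6 h7 h8
    · rw [h1, h2]
    · exact absurd hxy hbb
    · exact absurd hxy.symm (hgt' _).2.1
    · exact absurd hxy.symm hbb
    · rw [h4, h6]
    · exact absurd hxy.symm (hgt' _).2.2
    · exact absurd hxy (hgt' _).2.1
    · exact absurd hxy (hgt' _).2.2
    · simpa using hg hxy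
  obtain ⟨f, hf, hfg⟩ := exists_map_of_injective hAB hcover hn.1 hinj (fun x => by
    simp only [g']
    split_ifs with h h'
    · rw [h]; exact hab
    · rw [h']; exact hab'
    · exact (hgt' ⟨x, x.2, h, h'⟩).1)
  refine ⟨f, hf, ?_, ?_⟩
  · rw [hfg ⟨a, ha⟩]; simp [g']
  · rw [hfg ⟨a', ha'⟩]; simp [g', haa.symm]

/-- A cut of porosity two with a balanced shore cuts off just one vertex of each colour. If
`A ∩ X` had two disjoint edges leaving `X`, a perfect matching containing both would cross at least
four times; so those edges are covered by one vertex, which violates the expansion of `A ∩ X`. -/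
lemma balanced_small (hAB : G.IsBipartiteWith A B) (hcover : A ∪ B = Set.univ)
    (hG : IsBrace G) (hcard : 6 ≤ Nat.card V) {X : Set V} (hX : porosity G X ≤ 2)
    (hbal : (A ∩ X).ncard = (B ∩ X).ncard) :
    (A ∩ X).ncard ≤ 1 ∨ A.ncard ≤ (A ∩ X).ncard + 1 := by
  by_contra! hcon
  rw [porosity_le_iff] at hX
  have hno : ∀ a ∈ A ∩ X, ∀ a' ∈ A ∩ X, ∀ b ∉ X, ∀ b' ∉ X, G.Adj a b → G.Adj a' b' →
      a ≠ a' → b = b' := by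
    intro a ha a' ha' b hb b' hb' h h' hne
    by_contra hbb
    obtain ⟨f, hf, h1, h2⟩ := exists_map_of_two_edges hAB hcover hG hcard ha.1 ha'.1 h h' hne hbb
    have h3 := crossing_count hAB hcover hf X
    have h4 := hX f hf
    have h5 : ({a, a'} : Set V) ⊆ A ∩ crossing f X := by
      rintro v (rfl | rfl)
      · exact ⟨ha.1, ha.2, by rwa [h1]⟩
      · exact ⟨ha'.1, ha'.2, by rwa [h2]⟩
    have h6 := Set.ncard_le_ncard h5
    rw [Set.ncard_pair hne] at h6
    omega
  have hexp : ∀ S ⊆ A ∩ X, S.Nonempty → S.ncard + 2 ≤ (nbhd G S).ncard := fun S hS hne =>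
    card_add_two_le_nbhd hAB hcover hG hcard (hS.trans Set.inter_subset_left) hne
      (by have := Set.ncard_le_ncard hS; omega)
  have hne : (A ∩ X).Nonempty := by rw [← Set.ncard_pos]; omega
  have hbig := hexp _ le_rfl hne
  -- the neighbours of `A ∩ X` do not all lie in `X`
  have h1 : ∃ a ∈ A ∩ X, ∃ b ∉ X, G.Adj a b := by
    by_contra! h
    have : nbhd G (A ∩ X) ⊆ B ∩ X := by
      rintro y ⟨x, hx, hxy⟩
      exact ⟨hAB.mem_of_mem_adj hx.1 hxy, by_contra fun hy => h x hx y hy hxy⟩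
    have := Set.ncard_le_ncard this
    omega
  obtain ⟨a, ha, b, hb, hab⟩ := h1
  -- not every edge leaving `A ∩ X` ends in `b`
  have h2 : ∃ a' ∈ A ∩ X, ∃ b' ∉ X, G.Adj a' b' ∧ b' ≠ b := by
    by_contra! h
    have : nbhd G (A ∩ X) ⊆ insert b (B ∩ X) := by
      rintro y ⟨x, hx, hxy⟩
      by_cases hy : y ∈ X
      · exact Or.inr ⟨hAB.mem_of_mem_adj hx.1 hxy, hy⟩
      · exact Or.inl (h x hx y hy hxy)
    have := (Set.ncard_le_ncard this).trans (Set.ncard_insert_le _ _)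
    omega
  obtain ⟨a', ha', b', hb', hab', hbb⟩ := h2
  have haa : a = a' := by_contra fun h => hbb (hno a ha a' ha' b hb b' hb' hab hab' h).symm
  subst haa
  -- and not every such edge starts in `a`
  have h3 : ∃ c ∈ A ∩ X, ∃ d ∉ X, G.Adj c d ∧ c ≠ a := by
    by_contra! h
    have : nbhd G ((A ∩ X) \ {a}) ⊆ B ∩ X := by
      rintro y ⟨x, hx, hxy⟩
      exact ⟨hAB.mem_of_mem_adj hx.1.1 hxy, by_contra fun hy => hx.2 (h x hx.1 y hy hxy)⟩
    have h4 := Set.ncard_le_ncard this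
    have h5 := Set.ncard_sdiff_singleton_add_one ha
    have h6 := hexp ((A ∩ X) \ {a}) Set.sdiff_subset (by rw [← Set.ncard_pos]; omega)
    omega
  obtain ⟨c, hc, d, hd, hcd, hca⟩ := h3
  have e1 := hno a ha c hc b hb d hd hab hcd hca.symm
  have e2 := hno a ha c hc b' hb' d hd hab' hcd hca.symm
  exact hbb (e2.trans e1.symm)

/-- A shore of a cut of porosity two with two more vertices in `B` than in `A` has all edges of the
cut at `B`, since every crossing edge starting in `A` would have to be compensated. -/
lemma nbhd_subset_of_imbalance (hAB : G.IsBipartiteWith A B) (hcover : A ∪ B = Set.univ)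
    (hG : IsBrace G) {X : Set V} (hX : porosity G X ≤ 2)
    (himb : (A ∩ X).ncard + 2 = (B ∩ X).ncard) : nbhd G (A ∩ X) ⊆ B ∩ X := by
  rintro y ⟨x, hx, hxy⟩
  refine ⟨hAB.mem_of_mem_adj hx.1 hxy, by_contra fun hy => ?_⟩
  obtain ⟨f, hf, hfx⟩ := hG.2.1.exists_map hxy
  have h1 := crossing_count hAB hcover hf X
  have h2 := porosity_le_iff.1 hX f hf
  have h3 : 0 < (A ∩ crossing f X).ncard :=
    (Set.ncard_pos).2 ⟨x, hx.1, hx.2, hfx ▸ hy⟩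
  omega

lemma imbalance_le (hAB : G.IsBipartiteWith A B) (hcover : A ∪ B = Set.univ)
    (hG : IsBrace G) (hcard : 6 ≤ Nat.card V) {X : Set V} (hX : porosity G X ≤ 2) :
    (A ∩ X).ncard ≤ (B ∩ X).ncard + 2 ∧ (B ∩ X).ncard ≤ (A ∩ X).ncard + 2 := by
  obtain ⟨f, hf⟩ := exists_matchingMap_of_brace hG hcard
  have h1 := crossing_count hAB hcover hf X
  have h2 := porosity_le_iff.1 hX f hf
  omega

/-- An odd cut of porosity at most two is tight, hence trivial. -/
lemma odd_trivial (hAB : G.IsBipartiteWith A B) (hcover : A ∪ B = Set.univ)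
    (hG : IsBrace G) {X : Set V} (hX : porosity G X ≤ 2) (hodd : X.ncard % 2 = 1) :
    X.ncard = 1 ∨ X.ncard + 1 = Nat.card V := by
  have h := hG.2.2 X (isTightCut_of_crossing fun f hf => by
    have h1 := crossing_count hAB hcover hf X
    have h2 := porosity_le_iff.1 hX f hf
    have h3 := ncard_colour_split hAB hcover X
    omega)
  have := Set.ncard_add_ncard_compl X
  rcases h with h | h <;> omega

/-- A perfect matching through an edge of an even cut crosses it at least twice. -/
lemma two_le_porosity (hAB : G.IsBipartiteWith A B) (hcover : A ∪ B = Set.univ)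
    (hG : IsBrace G) (hcard : 6 ≤ Nat.card V) {X : Set V} (hX : X.ncard = 2) :
    2 ≤ porosity G X := by
  by_contra! hlt
  have h := porosity_le_iff.1 (Nat.le_of_lt_succ hlt)
  have hc := Set.ncard_add_ncard_compl X
  obtain ⟨u, hu, v, hv, huv⟩ := exists_adj_leaving hG.2.1.1 (S := X)
    (by rw [← Set.ncard_pos]; omega) (by rw [← Set.ncard_pos]; omega)
  obtain ⟨f, hf, hfu⟩ := hG.2.1.exists_map huv
  have hpos : 0 < (crossing f X).ncard := (Set.ncard_pos).2 ⟨u, hu, hfu ▸ hv⟩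
  have h1 := crossing_count hAB hcover hf X
  have h2 := ncard_colour_split hAB hcover X
  have := h f hf
  omega

end Bipartite

end PMWidth

/-! ### Shores of tree decompositions -/

namespace PMWidth

section Components

variable {N : Type*} {T : SimpleGraph N}

/-- The vertices of the component of `T - xy` that contains `x`. -/
def comp (T : SimpleGraph N) (x y : N) : Set N :=
  {z | (T.deleteEdges {s(x, y)}).Reachable x z}

lemma mem_comp_self (x y : N) : x ∈ comp T x y := SimpleGraph.Reachable.refl _

lemma comp_step {x y u v : N} (hu : u ∈ comp T x y) (h : T.Adj u v) (hne : s(u, v) ≠ s(x, y)) :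
    v ∈ comp T x y :=
  SimpleGraph.Reachable.trans hu (SimpleGraph.Adj.reachable (by simp [h]; simpa using hne))

/-- A set containing `x` that no edge of `T` other than `xy` leaves contains the whole component. -/
lemma comp_subset {x y : N} {D : Set N} (hx : x ∈ D)
    (h : ∀ u ∈ comp T x y, u ∈ D → ∀ v, T.Adj u v → s(u, v) ≠ s(x, y) → v ∈ D) :
    comp T x y ⊆ D := by
  intro z hz
  by_contra hzD
  obtain ⟨p⟩ := (hz : (T.deleteEdges {s(x, y)}).Reachable x z)
  obtain ⟨d, -, h1, h2⟩ := p.exists_boundary_dart (D ∩ comp T x y) ⟨hx, mem_comp_self x y⟩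
    (fun h => hzD h.1)
  have h3 := d.adj
  rw [SimpleGraph.deleteEdges_adj] at h3
  exact h2 ⟨h _ h1.2 h1.1 _ h3.1 h3.2, comp_step h1.2 h3.1 h3.2⟩

lemma comp_union (hT : T.Connected) (x y : N) : comp T x y ∪ comp T y x = Set.univ := by
  by_contra hne
  obtain ⟨u, hu, v, hv, h⟩ := exists_adj_leaving hT (S := comp T x y ∪ comp T y x)
    ⟨x, Or.inl (mem_comp_self x y)⟩ (Set.nonempty_compl.2 hne)
  by_cases he : s(u, v) = s(x, y)
  · rcases Sym2.eq_iff.1 he with ⟨-, rfl⟩ | ⟨-, rfl⟩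
    · exact hv (Or.inr (mem_comp_self _ _))
    · exact hv (Or.inl (mem_comp_self _ _))
  · rcases hu with hu | hu
    · exact hv (Or.inl (comp_step hu h he))
    · exact hv (Or.inr (comp_step hu h (by rwa [Sym2.eq_swap (a := y)])))

lemma comp_compl (hT : T.IsTree) {x y : N} (h : T.Adj x y) : (comp T x y)ᶜ = comp T y x := by
  refine IsCompl.compl_eq ⟨?_, codisjoint_iff.2 (comp_union hT.1 x y)⟩
  rw [Set.disjoint_left]
  intro z hz hz'
  have hb := SimpleGraph.isAcyclic_iff_forall_adj_isBridge.1 hT.2 h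
  rw [SimpleGraph.isBridge_iff] at hb
  refine hb (SimpleGraph.Reachable.trans hz ?_)
  have : (T.deleteEdges {s(y, x)}).Reachable y z := hz'
  rw [Sym2.eq_swap] at this
  exact this.symm

lemma notMem_comp (hT : T.IsTree) {x y : N} (h : T.Adj x y) : y ∉ comp T x y := by
  have := mem_comp_self (T := T) y x
  rwa [← comp_compl hT h] at this

lemma comp_subset_comp (hT : T.IsTree) {x y u : N} (hu : T.Adj x u) (huy : u ≠ y) :
    comp T u x ⊆ comp T x y := by
  refine comp_subset (comp_step (mem_comp_self x y) hu ?_) fun v hv hv' w hw _ =>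
    comp_step hv' hw ?_
  · intro h
    rcases Sym2.eq_iff.1 h with h | h
    · exact huy h.2
    · exact hu.ne h.2.symm
  · intro h
    rcases Sym2.eq_iff.1 h with ⟨rfl, -⟩ | ⟨rfl, rfl⟩
    · exact notMem_comp hT hu.symm hv
    · rename_i hne
      -- the edge `yx` does not occur, since `x` is not in the component
      exact notMem_comp hT hu.symm (comp_step hv hw hne)

lemma comp_disjoint (hT : T.IsTree) {x u w : N} (hu : T.Adj x u) (hw : T.Adj x w) (h : u ≠ w) :
    Disjoint (comp T u x) (comp T w x) := by
  have := comp_subset_comp hT hu h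
  rw [← comp_compl hT hw.symm] at this
  exact Set.disjoint_left.2 fun z h1 h2 => this h1 h2

lemma comp_eq_of_leaf {x y : N} (h : T.neighborSet x = {y}) : comp T x y = {x} := by
  refine Set.Subset.antisymm (comp_subset rfl ?_) (by simpa using mem_comp_self x y)
  rintro u - rfl v huv hne
  have : v ∈ T.neighborSet u := huv
  rw [h] at this
  rw [Set.mem_singleton_iff] at this
  exact absurd (by rw [this]) hne

lemma comp_eq_of_cubic (hT : T.IsTree) {x y u w : N} (h : T.neighborSet x = {y, u, w})
    (huy : u ≠ y) (hwy : w ≠ y) : comp T x y = {x} ∪ (comp T u x ∪ comp T w x) := by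
  have hu : T.Adj x u := by rw [← SimpleGraph.mem_neighborSet, h]; simp
  have hw : T.Adj x w := by rw [← SimpleGraph.mem_neighborSet, h]; simp
  have key : ∀ u, T.Adj x u → ∀ v ∈ comp T u x, ∀ z, T.Adj v z → z = x ∨ z ∈ comp T u x := by
    intro u hu v hv z hz
    by_cases he : s(v, z) = s(u, x)
    · rcases Sym2.eq_iff.1 he with ⟨-, rfl⟩ | ⟨-, rfl⟩
      · exact Or.inl rfl
      · exact Or.inr (mem_comp_self _ _)
    · exact Or.inr (comp_step hv hz he)
  refine Set.Subset.antisymm (comp_subset (Or.inl rfl) ?_) ?_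
  · rintro v - (hv | hv | hv) z hz hne
    · rw [Set.mem_singleton_iff] at hv
      subst hv
      have : z ∈ T.neighborSet v := hz
      rw [h] at this
      rcases this with rfl | rfl | rfl
      · exact absurd rfl hne
      · exact Or.inr (Or.inl (mem_comp_self _ _))
      · exact Or.inr (Or.inr (mem_comp_self _ _))
    · exact (key u hu v hv z hz).imp id Or.inl
    · exact (key w hw v hv z hz).imp id Or.inr
  · rintro v (rfl | hv | hv)
    · exact mem_comp_self _ _
    · exact comp_subset_comp hT hu huy hv
    · exact comp_subset_comp hT hw hwy hv

end Components

namespace PMDecomposition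

variable {V : Type*} (D : PMDecomposition V)

lemma mem_shore {t₁ t₂ : D.Node} {v : V} :
    v ∈ D.shore t₁ t₂ ↔ (D.leafEquiv.symm v : D.Node) ∈ comp D.tree t₁ t₂ := Iff.rfl

lemma shore_compl {t₁ t₂ : D.Node} (h : D.tree.Adj t₁ t₂) :
    (D.shore t₁ t₂)ᶜ = D.shore t₂ t₁ := by
  ext v
  rw [Set.mem_compl_iff, mem_shore, mem_shore, ← comp_compl D.isTree h, Set.mem_compl_iff]

/-- The shore at a tree edge consists of one vertex, or splits into the shores of the two further
edges at the end of the edge. -/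
lemma shore_cases {t₁ t₂ : D.Node} (h : D.tree.Adj t₁ t₂) :
    (∃ v, D.shore t₁ t₂ = {v} ∧ comp D.tree t₁ t₂ = {t₁}) ∨
    ∃ u w, D.tree.Adj u t₁ ∧ D.tree.Adj w t₁ ∧ D.shore t₁ t₂ = D.shore u t₁ ∪ D.shore w t₁ ∧
      Disjoint (D.shore u t₁) (D.shore w t₁) ∧ comp D.tree u t₁ ⊂ comp D.tree t₁ t₂ := by
  have hmem : t₂ ∈ D.tree.neighborSet t₁ := h
  rcases D.cubic t₁ with h1 | h3
  · left
    obtain ⟨y, hy⟩ := Set.ncard_eq_one.1 h1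
    have : t₂ = y := by rw [hy] at hmem; exact hmem
    subst this
    have hc := comp_eq_of_leaf hy
    refine ⟨D.leafEquiv ⟨t₁, h1⟩, ?_, hc⟩
    ext v
    rw [mem_shore, hc, Set.mem_singleton_iff, Set.mem_singleton_iff, ← Equiv.symm_apply_eq,
      Subtype.ext_iff]
  · right
    have h2 := Set.ncard_sdiff_singleton_add_one hmem (Set.finite_of_ncard_ne_zero (by omega))
    obtain ⟨u, w, huw, he⟩ := Set.ncard_eq_two.1 (show (D.tree.neighborSet t₁ \ {t₂}).ncard = 2 by
      omega)
    have hu : u ∈ D.tree.neighborSet t₁ \ {t₂} := by rw [he]; simp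
    have hw : w ∈ D.tree.neighborSet t₁ \ {t₂} := by rw [he]; simp
    have hN : D.tree.neighborSet t₁ = {t₂, u, w} := by
      rw [← he, Set.insert_sdiff_singleton, Set.insert_eq_of_mem hmem]
    have hc := comp_eq_of_cubic D.isTree hN hu.2 hw.2
    refine ⟨u, w, hu.1.symm, hw.1.symm, ?_, ?_, ?_⟩
    · ext v
      rw [Set.mem_union, mem_shore, mem_shore, mem_shore, hc]
      constructor
      · rintro (h | h)
        · -- the node `t₁` has degree three, so it is not a leaf
          have := (D.leafEquiv.symm v).2
          rw [Set.mem_singleton_iff.1 h] at this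
          have h1 : (D.tree.neighborSet t₁).ncard = 1 := this
          omega
        · exact h
      · exact Or.inr
    · rw [Set.disjoint_left]
      intro v
      exact fun h1 h2 => Set.disjoint_left.1 (comp_disjoint D.isTree hu.1 hw.1 huw) h1 h2
    · exact ⟨comp_subset_comp D.isTree hu.1 hu.2, fun hs =>
        notMem_comp D.isTree (SimpleGraph.Adj.symm hu.1) (hs (mem_comp_self _ _))⟩

lemma shore_nonempty {t₁ t₂ : D.Node} (h : D.tree.Adj t₁ t₂) : (D.shore t₁ t₂).Nonempty := by
  have := D.finite_node
  induction hk : (comp D.tree t₁ t₂).ncard using Nat.strong_induction_on generalizing t₁ t₂ with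
  | _ k ih =>
    rcases D.shore_cases h with ⟨v, hv, -⟩ | ⟨u, w, hu, -, hs, -, hlt⟩
    · rw [hv]; exact Set.singleton_nonempty v
    · rw [hs]
      exact (ih _ (hk ▸ Set.ncard_lt_ncard hlt) hu rfl).mono Set.subset_union_left

/-- A shore with at least two vertices splits into two smaller non-empty shores. -/
lemma shore_split [Finite V] {t₁ t₂ : D.Node} (h : D.tree.Adj t₁ t₂)
    (h2 : 2 ≤ (D.shore t₁ t₂).ncard) :
    ∃ u w, D.tree.Adj u t₁ ∧ D.tree.Adj w t₁ ∧ D.shore t₁ t₂ = D.shore u t₁ ∪ D.shore w t₁ ∧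
      Disjoint (D.shore u t₁) (D.shore w t₁) ∧ 0 < (D.shore u t₁).ncard ∧
      0 < (D.shore w t₁).ncard := by
  rcases D.shore_cases h with ⟨v, hv, -⟩ | ⟨u, w, hu, hw, hs, hd, -⟩
  · rw [hv, Set.ncard_singleton] at h2; omega
  · exact ⟨u, w, hu, hw, hs, hd, (Set.ncard_pos).2 (D.shore_nonempty hu),
      (Set.ncard_pos).2 (D.shore_nonempty hw)⟩

/-- Some tree edge separates a single vertex from the rest. -/
lemma exists_shore_singleton [Nonempty V] :
    ∃ t₁ t₂, D.tree.Adj t₁ t₂ ∧ (D.shore t₁ t₂).ncard = 1 := by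
  obtain ⟨v⟩ := ‹Nonempty V›
  have h := (D.leafEquiv.symm v).2
  obtain ⟨y, hy⟩ := Set.ncard_eq_one.1 h
  have hadj : D.tree.Adj (D.leafEquiv.symm v) y := by
    rw [← SimpleGraph.mem_neighborSet, hy]; rfl
  refine ⟨_, y, hadj, ?_⟩
  rw [Set.ncard_eq_one]
  refine ⟨v, ?_⟩
  ext w
  rw [mem_shore, comp_eq_of_leaf hy, Set.mem_singleton_iff, Set.mem_singleton_iff,
    ← Subtype.ext_iff, D.leafEquiv.symm.injective.eq_iff]

/-- A shore that is minimal among those with at least `k ≥ 2` vertices has at most `2k - 2`. -/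
lemma exists_shore_between [Finite V] {k : ℕ} (hk : 2 ≤ k) (hV : k + 1 ≤ Nat.card V) :
    ∃ t₁ t₂, D.tree.Adj t₁ t₂ ∧ k ≤ (D.shore t₁ t₂).ncard ∧
      (D.shore t₁ t₂).ncard + 2 ≤ 2 * k := by
  have : Nonempty V := (Nat.card_pos_iff.1 (by omega)).1
  obtain ⟨t₁, t₂, h, h1⟩ := D.exists_shore_singleton
  have hc := Set.ncard_add_ncard_compl (D.shore t₁ t₂)
  rw [D.shore_compl h] at hc
  have hex : ∃ m, ∃ t₁ t₂, D.tree.Adj t₁ t₂ ∧ k ≤ m ∧ (D.shore t₁ t₂).ncard = m :=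
    ⟨_, t₂, t₁, h.symm, by omega, rfl⟩
  classical
  obtain ⟨s₁, s₂, hs, hks, hsm⟩ := Nat.find_spec hex
  refine ⟨s₁, s₂, hs, by omega, ?_⟩
  obtain ⟨u, w, hu, hw, he, hd, hu0, hw0⟩ := D.shore_split hs (by omega)
  have hadd := Set.ncard_union_eq hd
  rw [← he] at hadd
  have hmin : ∀ x, D.tree.Adj x s₁ → (D.shore x s₁).ncard < (D.shore s₁ s₂).ncard →
      (D.shore x s₁).ncard < k := by
    intro x hx hlt
    by_contra! hge
    exact Nat.find_min hex (hsm ▸ hlt) ⟨x, s₁, hx, hge, rfl⟩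
  have := hmin u hu (by omega)
  have := hmin w hw (by omega)
  omega

lemma porosity_le_width [Finite V] (G : SimpleGraph V) {t₁ t₂ : D.Node} (h : D.tree.Adj t₁ t₂) :
    porosity G (D.shore t₁ t₂) ≤ D.width G := by
  refine le_csSup ⟨Nat.card V, ?_⟩ ⟨t₁, t₂, h, rfl⟩
  rintro _ ⟨t₁, t₂, -, rfl⟩
  refine porosity_le_iff.2 fun f _ => ?_
  rw [← Set.ncard_univ]
  exact Set.ncard_le_ncard (Set.subset_univ _)

end PMDecomposition

lemma two_le_width {V : Type*} [Finite V] {G : SimpleGraph V} {A B : Set V}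
    (hAB : G.IsBipartiteWith A B) (hcover : A ∪ B = Set.univ)
    (hG : IsBrace G) (hcard : 6 ≤ Nat.card V) (D : PMDecomposition V) : 2 ≤ D.width G := by
  obtain ⟨t₁, t₂, h, h1, h2⟩ := D.exists_shore_between le_rfl (by omega)
  exact (two_le_porosity hAB hcover hG hcard (by omega)).trans (D.porosity_le_width G h)

end PMWidth

/-! ### From a decomposition of width two to an elimination ordering -/

namespace PMWidth

/-- The subsets of `A` that can be built up from the empty set one vertex at a time such that each
intermediate set has at most two neighbours more than elements. -/
inductive Chain {V : Type*} (G : SimpleGraph V) (A : Set V) : Set V → Prop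
  | nil : Chain G A ∅
  | cons (S : Set V) (a : V) : Chain G A S → a ∈ A → a ∉ S →
      (nbhd G (insert a S)).ncard ≤ (insert a S).ncard + 2 → Chain G A (insert a S)

variable {V : Type*} [Finite V] {G : SimpleGraph V} {A B : Set V}

omit [Finite V] in
lemma Chain.subset {S : Set V} (h : Chain G A S) : S ⊆ A := by
  induction h with
  | nil => exact Set.empty_subset _
  | cons S a _ ha _ _ ih => exact Set.insert_subset ha ih

lemma Chain.extend (hAB : G.IsBipartiteWith A B) (hn : A.ncard = B.ncard) {S : Set V}
    (h : Chain G A S) (hS : A.ncard ≤ S.ncard + 3) : Chain G A A := by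
  induction hk : A.ncard - S.ncard generalizing S with
  | zero =>
    have : S = A := Set.eq_of_subset_of_ncard_le h.subset (by omega)
    exact this ▸ h
  | succ k ih =>
    obtain ⟨a, ha, haS⟩ := Set.exists_mem_notMem_of_ncard_lt_ncard (show S.ncard < A.ncard by omega)
    have hc := Set.ncard_insert_of_notMem haS
    have hb := Set.ncard_le_ncard (nbhd_subset hAB (Set.insert_subset ha h.subset))
    exact ih (.cons S a h ha haS (by omega)) (by omega) (by omega)

/-- A chain reaching `S` yields a numbering of `S` whose initial segments are the sets of the
chain. -/
lemma Chain.exists_numbering {S : Set V} (h : Chain G A S) :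
    ∃ g : V → ℕ, Set.InjOn g S ∧ (∀ a ∈ S, g a < S.ncard) ∧
      ∀ a ∈ S, (nbhd G {x | x ∈ S ∧ g x ≤ g a}).ncard ≤ {x | x ∈ S ∧ g x ≤ g a}.ncard + 2 := by
  classical
  induction h with
  | nil => exact ⟨fun _ => 0, by simp⟩
  | cons S a _ ha haS hle ih =>
    obtain ⟨g, hinj, hlt, hg⟩ := ih
    have hc := Set.ncard_insert_of_notMem haS
    let g' : V → ℕ := Function.update g a S.ncard
    have hga : g' a = S.ncard := Function.update_self _ _ _
    have hgx : ∀ x ∈ S, g' x = g x := fun x hx =>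
      Function.update_of_ne (fun h => haS (by rwa [← h])) _ _
    refine ⟨g', ?_, ?_, ?_⟩
    · rintro x (rfl | hx) y (rfl | hy) hxy
      · rfl
      · rw [hga, hgx y hy] at hxy; have := hlt y hy; omega
      · rw [hga, hgx x hx] at hxy; have := hlt x hx; omega
      · rw [hgx x hx, hgx y hy] at hxy; exact hinj hx hy hxy
    · rintro x (rfl | hx)
      · omega
      · rw [hgx x hx]; have := hlt x hx; omega
    · rintro c (rfl | hc')
      · have : {x | x ∈ insert c S ∧ g' x ≤ g' c} = insert c S := by
          ext x
          refine ⟨fun h => h.1, fun h => ⟨h, ?_⟩⟩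
          rcases h with rfl | h
          · exact le_rfl
          · rw [hga, hgx x h]; exact (hlt x h).le
        rwa [this]
      · have : {x | x ∈ insert a S ∧ g' x ≤ g' c} = {x | x ∈ S ∧ g x ≤ g c} := by
          ext x
          rw [Set.mem_ofPred_eq, Set.mem_ofPred_eq, hgx c hc']
          constructor
          · rintro ⟨rfl | h, h'⟩
            · rw [hga] at h'; have := hlt c hc'; omega
            · exact ⟨h, by rwa [hgx x h] at h'⟩
          · rintro ⟨h, h'⟩
            exact ⟨Or.inr h, by rwa [hgx x h]⟩
        rw [this]
        exact hg c hc'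

lemma Chain.exists_ordering (h : Chain G A A) :
    ∃ lam : Ordering A, ∀ a, (reach G lam a).ncard ≤ (pred lam a).ncard + 2 := by
  obtain ⟨g, hinj, hlt, hg⟩ := h.exists_numbering
  let l : A → Fin A.ncard := fun a => ⟨g a, hlt a a.2⟩
  have hl : Function.Bijective l := by
    have : Fintype A := Fintype.ofFinite _
    rw [Fintype.bijective_iff_injective_and_card]
    refine ⟨fun x y hxy => Subtype.ext (hinj x.2 y.2 (congrArg Fin.val hxy)), ?_⟩
    rw [← Nat.card_eq_fintype_card, Fintype.card_fin]
    rfl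
  refine ⟨Equiv.ofBijective l hl, fun a => ?_⟩
  have hp : pred (Equiv.ofBijective l hl) a = {x | x ∈ A ∧ g x ≤ g a} := by
    ext x
    constructor
    · rintro ⟨a', h, rfl⟩
      exact ⟨a'.2, h⟩
    · rintro ⟨hx, h⟩
      exact ⟨⟨x, hx⟩, h, rfl⟩
  have hr : reach G (Equiv.ofBijective l hl) a = nbhd G (pred (Equiv.ofBijective l hl) a) := rfl
  rw [hr, hp]
  exact hg a a.2

/-- In a decomposition of width two, a shore with two more vertices in `B` than in `A` that is not
a pair splits into a balanced shore and another one of imbalance two: both parts are even,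
as odd shores are trivial. -/
lemma PMDecomposition.split_imbalance (hAB : G.IsBipartiteWith A B) (hcover : A ∪ B = Set.univ)
    (hG : IsBrace G) (hcard : 6 ≤ Nat.card V) {D : PMDecomposition V} (hD : D.width G ≤ 2)
    {t₁ t₂ : D.Node} (h : D.tree.Adj t₁ t₂)
    (himb : (A ∩ D.shore t₁ t₂).ncard + 2 = (B ∩ D.shore t₁ t₂).ncard)
    (h3 : 3 ≤ (D.shore t₁ t₂).ncard) :
    ∃ u w, D.tree.Adj u t₁ ∧ D.tree.Adj w t₁ ∧ D.shore t₁ t₂ = D.shore u t₁ ∪ D.shore w t₁ ∧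
      Disjoint (D.shore u t₁) (D.shore w t₁) ∧ 0 < (D.shore u t₁).ncard ∧
      0 < (D.shore w t₁).ncard ∧ (A ∩ D.shore u t₁).ncard = (B ∩ D.shore u t₁).ncard ∧
      (A ∩ D.shore w t₁).ncard + 2 = (B ∩ D.shore w t₁).ncard := by
  have hn := ncard_colours_eq hAB hcover hG hcard
  have hpor : ∀ {x y}, D.tree.Adj x y → porosity G (D.shore x y) ≤ 2 := fun h =>
    (D.porosity_le_width G h).trans hD
  have hB : (B ∩ D.shore t₁ t₂).ncard ≤ B.ncard := Set.ncard_le_ncard Set.inter_subset_left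
  have hsum := ncard_colour_split hAB hcover (D.shore t₁ t₂)
  obtain ⟨u, w, hu, hw, he, hd, hu0, hw0⟩ := D.shore_split h (by omega)
  have hadd := Set.ncard_union_eq hd
  have hadd' : ∀ C : Set V, (C ∩ D.shore t₁ t₂).ncard =
      (C ∩ D.shore u t₁).ncard + (C ∩ D.shore w t₁).ncard := fun C => by
    rw [he, Set.inter_union_distrib_left,
      Set.ncard_union_eq (hd.mono Set.inter_subset_right Set.inter_subset_right)]
  have hA' := hadd' A
  have hB' := hadd' B
  rw [← he] at hadd
  have hu1 := imbalance_le hAB hcover hG hcard (hpor hu)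
  have hw1 := imbalance_le hAB hcover hG hcard (hpor hw)
  have hsu := ncard_colour_split hAB hcover (D.shore u t₁)
  have hsw := ncard_colour_split hAB hcover (D.shore w t₁)
  have hou := odd_trivial hAB hcover hG (hpor hu)
  have how := odd_trivial hAB hcover hG (hpor hw)
  have hcases : ((A ∩ D.shore u t₁).ncard = (B ∩ D.shore u t₁).ncard ∧
      (A ∩ D.shore w t₁).ncard + 2 = (B ∩ D.shore w t₁).ncard) ∨
      ((A ∩ D.shore w t₁).ncard = (B ∩ D.shore w t₁).ncard ∧
      (A ∩ D.shore u t₁).ncard + 2 = (B ∩ D.shore u t₁).ncard) := by omega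
  rcases hcases with ⟨h1, h2⟩ | ⟨h1, h2⟩
  · exact ⟨u, w, hu, hw, he, hd, hu0, hw0, h1, h2⟩
  · exact ⟨w, u, hw, hu, by rw [he, Set.union_comm], hd.symm, hw0, hu0, h1, h2⟩

/-- Walking down from a shore of imbalance two, one passes shores of imbalance two that differ by
balanced shores, that is, by pairs consisting of one vertex of each colour. -/
lemma PMDecomposition.chain_of_shore (hAB : G.IsBipartiteWith A B) (hcover : A ∪ B = Set.univ)
    (hG : IsBrace G) (hcard : 6 ≤ Nat.card V) {D : PMDecomposition V} (hD : D.width G ≤ 2)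
    {t₁ t₂ : D.Node} (h : D.tree.Adj t₁ t₂)
    (himb : (A ∩ D.shore t₁ t₂).ncard + 2 = (B ∩ D.shore t₁ t₂).ncard) :
    Chain G A (A ∩ D.shore t₁ t₂) := by
  have hn := ncard_colours_eq hAB hcover hG hcard
  induction hk : (D.shore t₁ t₂).ncard using Nat.strong_induction_on generalizing t₁ t₂ with
  | _ k ih =>
    have hsum := ncard_colour_split hAB hcover (D.shore t₁ t₂)
    by_cases h3 : 3 ≤ (D.shore t₁ t₂).ncard
    · obtain ⟨u, w, hu, hw, he, hd, hu0, hw0, hbal, himb'⟩ :=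
        D.split_imbalance hAB hcover hG hcard hD h himb h3
      have hadd := Set.ncard_union_eq hd
      rw [← he] at hadd
      have hsu := ncard_colour_split hAB hcover (D.shore u t₁)
      have hsw := ncard_colour_split hAB hcover (D.shore w t₁)
      have hB : (B ∩ D.shore t₁ t₂).ncard ≤ B.ncard := Set.ncard_le_ncard Set.inter_subset_left
      have hsmall := balanced_small hAB hcover hG hcard
        ((D.porosity_le_width G hu).trans hD) hbal
      obtain ⟨a, ha⟩ := Set.ncard_eq_one.1 (show (A ∩ D.shore u t₁).ncard = 1 by omega)
      have haU : a ∈ A ∩ D.shore u t₁ := by rw [ha]; rfl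
      have hins : A ∩ D.shore t₁ t₂ = insert a (A ∩ D.shore w t₁) := by
        rw [he, Set.inter_union_distrib_left, ha, Set.singleton_union]
      have hnb := Set.ncard_le_ncard (nbhd_subset_of_imbalance hAB hcover hG
        ((D.porosity_le_width G h).trans hD) himb)
      rw [hins] at hnb ⊢
      refine .cons _ a (ih _ (by omega) hw himb' rfl) haU.1
        (fun hm => Set.disjoint_left.1 hd haU.2 hm.2) ?_
      rwa [← hins, himb, hins]
    · have : A ∩ D.shore t₁ t₂ = ∅ := by rw [← Set.ncard_eq_zero]; omega
      rw [this]
      exact .nil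

/-- Walking down from a shore with two more vertices in `A` than in `B`, one arrives at a pair of
vertices of `A`. -/
lemma PMDecomposition.exists_pair_shore (hAB : G.IsBipartiteWith A B)
    (hcover : A ∪ B = Set.univ)
    (hG : IsBrace G) (hcard : 6 ≤ Nat.card V) {D : PMDecomposition V} (hD : D.width G ≤ 2)
    {t₁ t₂ : D.Node} (h : D.tree.Adj t₁ t₂)
    (himb : (A ∩ D.shore t₁ t₂).ncard = (B ∩ D.shore t₁ t₂).ncard + 2) :
    ∃ s₁ s₂, D.tree.Adj s₁ s₂ ∧ (A ∩ D.shore s₁ s₂).ncard = (B ∩ D.shore s₁ s₂).ncard + 2 ∧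
      (D.shore s₁ s₂).ncard = 2 := by
  induction hk : (D.shore t₁ t₂).ncard using Nat.strong_induction_on generalizing t₁ t₂ with
  | _ k ih =>
    have hsum := ncard_colour_split hAB hcover (D.shore t₁ t₂)
    by_cases h3 : 3 ≤ (D.shore t₁ t₂).ncard
    · obtain ⟨u, w, hu, hw, he, hd, hu0, hw0, hbal, himb'⟩ :=
        D.split_imbalance hAB.symm (by rwa [Set.union_comm]) hG hcard hD h himb.symm h3
      have hadd := Set.ncard_union_eq hd
      rw [← he] at hadd
      exact ih _ (by omega) hw himb'.symm rfl
    · exact ⟨t₁, t₂, h, himb, by omega⟩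

/-- From a decomposition of width two to an elimination ordering. -/
lemma exists_ordering_of_width_le_two (hAB : G.IsBipartiteWith A B) (hcover : A ∪ B = Set.univ)
    (hG : IsBrace G) (hcard : 6 ≤ Nat.card V) {D : PMDecomposition V} (hD : D.width G ≤ 2) :
    ∃ lam : Ordering A, ∀ a, (reach G lam a).ncard ≤ (pred lam a).ncard + 2 := by
  have hn := ncard_colours_eq hAB hcover hG hcard
  apply Chain.exists_ordering
  by_cases h4 : A.ncard ≤ 3
  · exact Chain.nil.extend hAB hn.1 (by simpa using h4)
  have hcompl : ∀ {x y}, D.tree.Adj x y → ∀ C : Set V,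
      (C ∩ D.shore x y).ncard + (C ∩ D.shore y x).ncard = C.ncard := fun hxy C => by
    rw [← D.shore_compl hxy, ← Set.sdiff_eq, Set.ncard_inter_add_ncard_sdiff_eq_ncard]
  -- a shore with four vertices cannot be balanced
  obtain ⟨t₁, t₂, h, hlo, hhi⟩ := D.exists_shore_between (k := 3) (by norm_num) (by omega)
  have hpor := (D.porosity_le_width G h).trans hD
  have hsum := ncard_colour_split hAB hcover (D.shore t₁ t₂)
  have himb := imbalance_le hAB hcover hG hcard hpor
  have hodd := odd_trivial hAB hcover hG hpor
  have hbal := balanced_small hAB hcover hG hcard hpor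
  have hA := hcompl h A
  have hB := hcompl h B
  have hex : ∃ x y, D.tree.Adj x y ∧ (A ∩ D.shore x y).ncard = (B ∩ D.shore x y).ncard + 2 := by
    by_cases hlt : (A ∩ D.shore t₁ t₂).ncard = (B ∩ D.shore t₁ t₂).ncard + 2
    · exact ⟨t₁, t₂, h, hlt⟩
    · exact ⟨t₂, t₁, h.symm, by omega⟩
  obtain ⟨x, y, hxy, hxy'⟩ := hex
  obtain ⟨s₁, s₂, hs, hs1, hs2⟩ := D.exists_pair_shore hAB hcover hG hcard hD hxy hxy'
  have hsA := hcompl hs A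
  have hsB := hcompl hs B
  have hs3 := ncard_colour_split hAB hcover (D.shore s₁ s₂)
  exact (D.chain_of_shore hAB hcover hG hcard hD hs.symm (by omega)).extend hAB hn.1 (by omega)

end PMWidth

/-! ### Caterpillar decompositions -/

namespace PMWidth

/-- The graph joining every node to its parent; a root is its own parent. -/
def parentGraph {N : Type*} (par : N → N) : SimpleGraph N :=
  SimpleGraph.fromRel fun x y => par x = y

section ParentGraph

variable {N : Type*} {par : N → N} {r : N} {rank : N → ℕ}

lemma parentGraph_adj {x y : N} : (parentGraph par).Adj x y ↔ x ≠ y ∧ (par x = y ∨ par y = x) := by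
  simp [parentGraph]

lemma parentGraph_adj_parent (hrank : ∀ x, x ≠ r → rank (par x) < rank x) {x : N} (hx : x ≠ r) :
    (parentGraph par).Adj x (par x) :=
  parentGraph_adj.2 ⟨fun h => by have := hrank x hx; rw [← h] at this; exact lt_irrefl _ this,
    Or.inl rfl⟩

/-- Removing the edge from `x` to its parent cuts off the set `D` of descendants of `x`, which is
characterised by being closed under parents below `x` and under children. -/
lemma comp_parentGraph (hrank : ∀ x, x ≠ r → rank (par x) < rank x) {x : N} {D : Set N}
    (hxD : x ∈ D) (hrD : r ∉ D) (hpD : par x ∉ D) (hD : ∀ y, y ≠ x → (y ∈ D ↔ par y ∈ D)) :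
    comp (parentGraph par) x (par x) = D := by
  refine Set.Subset.antisymm (comp_subset hxD fun u _ hu v huv hne => ?_) fun y hy => ?_
  · rcases (parentGraph_adj.1 huv).2 with rfl | rfl
    · exact (hD u (by rintro rfl; exact hne rfl)).1 hu
    · by_cases h : v = x
      · exact h ▸ hxD
      · exact (hD v h).2 hu
  · induction hk : rank y using Nat.strong_induction_on generalizing y with
    | _ k ih =>
      by_cases h : y = x
      · exact h ▸ mem_comp_self _ _
      · have hyr : y ≠ r := by rintro rfl; exact hrD hy
        have hpy := (hD y h).1 hy
        refine comp_step (ih _ (hk ▸ hrank y hyr) _ hpy rfl)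
          (parentGraph_adj_parent hrank hyr).symm fun he => ?_
        rcases Sym2.eq_iff.1 he with ⟨-, h'⟩ | ⟨-, h'⟩
        · exact hpD (h' ▸ hy)
        · exact h h'

lemma parentGraph_connected (hrank : ∀ x, x ≠ r → rank (par x) < rank x) :
    (parentGraph par).Connected := by
  have key : ∀ x, (parentGraph par).Reachable x r := by
    intro x
    induction hk : rank x using Nat.strong_induction_on generalizing x with
    | _ k ih =>
      by_cases h : x = r
      · exact h ▸ SimpleGraph.Reachable.refl _
      · exact (parentGraph_adj_parent hrank h).reachable.trans (ih _ (hk ▸ hrank x h) _ rfl)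
  exact (SimpleGraph.connected_iff _).2 ⟨fun x y => (key x).trans (key y).symm, ⟨r⟩⟩

lemma parentGraph_isTree (hrank : ∀ x, x ≠ r → rank (par x) < rank x) (hr : par r = r)
    (D : N → Set N) (hxD : ∀ x, x ∈ D x) (hrD : ∀ x, x ≠ r → r ∉ D x)
    (hpD : ∀ x, x ≠ r → par x ∉ D x) (hD : ∀ x, x ≠ r → ∀ y, y ≠ x → (y ∈ D x ↔ par y ∈ D x)) :
    (parentGraph par).IsTree := by
  refine ⟨parentGraph_connected hrank, ?_⟩
  have key : ∀ x, x ≠ r → ¬ ((parentGraph par).deleteEdges {s(x, par x)}).Reachable x (par x) := by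
    intro x hx h
    have h' : par x ∈ comp (parentGraph par) x (par x) := h
    rw [comp_parentGraph hrank (hxD x) (hrD x hx) (hpD x hx) (hD x hx)] at h'
    exact hpD x hx h'
  rw [SimpleGraph.isAcyclic_iff_forall_adj_isBridge]
  intro v w hvw
  rw [SimpleGraph.isBridge_iff]
  obtain ⟨hne, rfl | rfl⟩ := parentGraph_adj.1 hvw
  · exact key v (by rintro rfl; exact hne hr.symm)
  · rw [Sym2.eq_swap]
    exact fun h => key w (by rintro rfl; exact hne hr) h.symm

end ParentGraph

/-- The nodes of the cubic caterpillar: a path of `k + 1` spine nodes, `k + 3` legs attached to it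
(two at each end of the path and one at every inner spine node), and two leaves at each leg. -/
inductive CaterpillarNode (k : ℕ) : Type
  | leaf (i : Fin (k + 3)) (b : Bool)
  | leg (i : Fin (k + 3))
  | spine (i : Fin (k + 1))

namespace CaterpillarNode

variable {k : ℕ}

/-- The parent in the caterpillar rooted at its last spine node. The legs numbered `0` and `1` hang
on the first spine node, those numbered `k + 1` and `k + 2` on the last one. -/
def parent : CaterpillarNode k → CaterpillarNode k
  | leaf i _ => leg i
  | leg i => spine ⟨min (i - 1) k, by omega⟩
  | spine i => spine ⟨min (i + 1) k, by omega⟩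

/-- The root of the caterpillar. -/
def root : CaterpillarNode k := spine ⟨k, by omega⟩

/-- A bound on the distance to the root. -/
def depth : CaterpillarNode k → ℕ
  | leaf _ _ => k + 2
  | leg _ => k + 1
  | spine i => k - i

/-- The descendants of a node other than the root, including the node itself. -/
def descendants : CaterpillarNode k → Set (CaterpillarNode k)
  | leaf i b => {leaf i b}
  | leg i => {y | match y with
    | leaf j _ => j = i
    | leg j => j = i
    | spine _ => False}
  | spine i => {y | match y with
    | leaf j _ => (j : ℕ) ≤ i + 1
    | leg j => (j : ℕ) ≤ i + 1
    | spine j => j ≤ i}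

lemma depth_parent (x : CaterpillarNode k) (hx : x ≠ root) : depth (parent x) < depth x := by
  rcases x with ⟨i, b⟩ | ⟨i⟩ | ⟨i, hi⟩
  · simp [parent, depth]
  · simp only [parent, depth]; omega
  · simp only [parent, depth]
    have : i ≠ k := fun h => hx (by simp [root, h])
    omega

lemma mem_descendants_self (x : CaterpillarNode k) : x ∈ descendants x := by
  rcases x with ⟨i, b⟩ | ⟨i⟩ | ⟨i⟩ <;> simp [descendants]

lemma root_notMem (x : CaterpillarNode k) (hx : x ≠ root) : root ∉ descendants x := by
  rcases x with ⟨i, b⟩ | ⟨i⟩ | ⟨i, hi⟩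
  · simp [descendants, root]
  · simp [descendants, root]
  · have : i ≠ k := fun h => hx (by simp [root, h])
    simp only [descendants, root, Set.mem_ofPred_eq, Fin.mk_le_mk]
    omega

lemma parent_notMem (x : CaterpillarNode k) (hx : x ≠ root) : parent x ∉ descendants x := by
  rcases x with ⟨i, b⟩ | ⟨i⟩ | ⟨i, hi⟩
  · simp [descendants, parent]
  · simp [descendants, parent]
  · have : i ≠ k := fun h => hx (by simp [root, h])
    simp only [descendants, parent, Set.mem_ofPred_eq, Fin.mk_le_mk]
    omega

lemma mem_descendants_iff_parent (x : CaterpillarNode k) (hx : x ≠ root) (y : CaterpillarNode k)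
    (hyx : y ≠ x) : y ∈ descendants x ↔ parent y ∈ descendants x := by
  rcases x with ⟨i, b⟩ | ⟨i⟩ | ⟨i, hi⟩
  · rcases y with ⟨j, c⟩ | ⟨j⟩ | ⟨j⟩ <;> simp_all [descendants, parent]
  · rcases y with ⟨j, c⟩ | ⟨j⟩ | ⟨j⟩ <;> simp_all [descendants, parent]
  · have hik : i ≠ k := fun h => hx (by simp [root, h])
    rcases y with ⟨j, c⟩ | ⟨j⟩ | ⟨j, hj⟩
    · simp [descendants, parent]
    · simp only [descendants, parent, Set.mem_ofPred_eq, Fin.mk_le_mk]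
      omega
    · have hji : j ≠ i := fun h => hyx (by simp [h])
      simp only [descendants, parent, Set.mem_ofPred_eq, Fin.mk_le_mk]
      omega

/-- The cubic caterpillar. -/
def tree (k : ℕ) : SimpleGraph (CaterpillarNode k) := parentGraph parent

lemma parent_root : parent (root : CaterpillarNode k) = root := by
  simp [parent, root]

lemma tree_isTree : (tree k).IsTree :=
  parentGraph_isTree depth_parent parent_root descendants mem_descendants_self root_notMem
    parent_notMem mem_descendants_iff_parent

lemma comp_tree (x : CaterpillarNode k) (hx : x ≠ root) :
    comp (tree k) x (parent x) = descendants x :=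
  comp_parentGraph depth_parent (mem_descendants_self x) (root_notMem x hx) (parent_notMem x hx)
    (mem_descendants_iff_parent x hx)

lemma ncard_neighborSet_leaf (i : Fin (k + 3)) (b : Bool) :
    ((tree k).neighborSet (leaf i b)).ncard = 1 := by
  rw [Set.ncard_eq_one]
  refine ⟨leg i, ?_⟩
  ext y
  rw [SimpleGraph.mem_neighborSet, tree, parentGraph_adj]
  rcases y with ⟨j, c⟩ | ⟨j⟩ | ⟨j⟩ <;> simp [parent, eq_comm]

lemma ncard_neighborSet_leg (i : Fin (k + 3)) :
    ((tree k).neighborSet (leg i)).ncard = 3 := by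
  rw [Set.ncard_eq_three]
  refine ⟨leaf i true, leaf i false, parent (leg i), by simp, by simp [parent],
    by simp [parent], ?_⟩
  ext y
  rw [SimpleGraph.mem_neighborSet, tree, parentGraph_adj]
  rcases y with ⟨j, c⟩ | ⟨j⟩ | ⟨j⟩
  · cases c <;> simp [parent]
  · simp [parent]
  · simp [parent, eq_comm]

lemma ncard_neighborSet_spine (i : Fin (k + 1)) :
    ((tree k).neighborSet (spine i)).ncard = 3 := by
  obtain ⟨i, hi⟩ := i
  rw [Set.ncard_eq_three]
  refine ⟨leg ⟨i + 1, by omega⟩, if i = 0 then leg ⟨0, by omega⟩ else spine ⟨i - 1, by omega⟩,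
    if h : i = k then leg ⟨k + 2, by omega⟩ else spine ⟨i + 1, by omega⟩, ?_, ?_, ?_, ?_⟩
  · split_ifs <;> simp
  · split_ifs with h
    · simp [h]
    · simp
  · split_ifs
    · simp
    · simp
    · simp
    · simp only [ne_eq, spine.injEq, Fin.mk.injEq]; omega
  · ext y
    rw [SimpleGraph.mem_neighborSet, tree, parentGraph_adj]
    simp only [Set.mem_insert_iff, Set.mem_singleton_iff]
    rcases y with ⟨j, c⟩ | ⟨j, hj⟩ | ⟨j, hj⟩
    · split_ifs <;> simp [parent]
    · split_ifs <;> simp [parent] <;> omega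
    · split_ifs <;> simp [parent] <;> omega

instance : Finite (CaterpillarNode k) := by
  refine Finite.of_surjective
    (Sum.elim (fun p : Fin (k + 3) × Bool => leaf p.1 p.2) (Sum.elim leg spine)) ?_
  rintro (⟨i, b⟩ | ⟨i⟩ | ⟨i⟩)
  · exact ⟨.inl (i, b), rfl⟩
  · exact ⟨.inr (.inl i), rfl⟩
  · exact ⟨.inr (.inr i), rfl⟩

/-- The leaves of the caterpillar are those it is built with. -/
noncomputable def leavesEquiv (k : ℕ) : Fin (k + 3) × Bool ≃ leaves (tree k) :=
  Equiv.ofBijective (fun p => ⟨leaf p.1 p.2, ncard_neighborSet_leaf p.1 p.2⟩) <| by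
    constructor
    · rintro ⟨i, b⟩ ⟨j, c⟩ h
      have h' : leaf i b = leaf j c := congrArg Subtype.val h
      simpa using h'
    · rintro ⟨⟨i, b⟩ | ⟨i⟩ | ⟨i⟩, h⟩
      · exact ⟨(i, b), rfl⟩
      · have h' : ((tree k).neighborSet (leg i)).ncard = 1 := h
        rw [ncard_neighborSet_leg] at h'; omega
      · have h' : ((tree k).neighborSet (spine i)).ncard = 1 := h
        rw [ncard_neighborSet_spine] at h'; omega

/-- The caterpillar decomposition whose `i`-th leg carries the vertices `e (i, true)` and
`e (i, false)`. -/
noncomputable def decomposition {V : Type*} (e : Fin (k + 3) × Bool ≃ V) : PMDecomposition V where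
  Node := CaterpillarNode k
  finite_node := inferInstance
  tree := tree k
  isTree := tree_isTree
  cubic := by
    rintro (⟨i, b⟩ | ⟨i⟩ | ⟨i⟩)
    · exact Or.inl (ncard_neighborSet_leaf i b)
    · exact Or.inr (ncard_neighborSet_leg i)
    · exact Or.inr (ncard_neighborSet_spine i)
  leafEquiv := (leavesEquiv k).symm.trans e

end CaterpillarNode

lemma porosity_le_ncard {V : Type*} [Finite V] (G : SimpleGraph V) (S : Set V) :
    porosity G S ≤ S.ncard :=
  porosity_le_iff.2 fun _ _ => Set.ncard_le_ncard fun _ h => h.1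

open CaterpillarNode in
/-- The cuts of a caterpillar decomposition at a leaf or leg have porosity at most two, and the
others are given by the initial segments of the sequence of legs. -/
lemma caterpillar_width_le {V : Type*} [Finite V] {G : SimpleGraph V} {k : ℕ}
    (e : Fin (k + 3) × Bool ≃ V)
    (h : ∀ j, 1 ≤ j → j ≤ k → porosity G {v | ((e.symm v).1 : ℕ) ≤ j} ≤ 2) :
    (decomposition e).width G ≤ 2 := by
  have hshore : ∀ x : CaterpillarNode k, x ≠ root → (decomposition e).shore x (parent x) =
      {v | leaf (e.symm v).1 (e.symm v).2 ∈ descendants x} := by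
    intro x hx
    rw [← comp_tree x hx]
    rfl
  have key : ∀ x : CaterpillarNode k, x ≠ root →
      porosity G ((decomposition e).shore x (parent x)) ≤ 2 := by
    intro x hx
    rw [hshore x hx]
    rcases x with ⟨i, b⟩ | ⟨i⟩ | ⟨i, hi⟩
    · refine (porosity_le_ncard G _).trans ((Set.ncard_le_ncard (t := {e (i, b)}) ?_).trans
        (by simp))
      intro v hv
      simp only [descendants, Set.mem_ofPred_eq, Set.mem_singleton_iff, leaf.injEq] at hv
      rw [Set.mem_singleton_iff, ← Equiv.symm_apply_eq]
      exact Prod.ext hv.1 hv.2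
    · refine (porosity_le_ncard G _).trans
        ((Set.ncard_le_ncard (t := {e (i, true), e (i, false)}) ?_).trans
          ((Set.ncard_insert_le _ _).trans (by simp)))
      intro v hv
      simp only [descendants, Set.mem_ofPred_eq] at hv
      rw [Set.mem_insert_iff, Set.mem_singleton_iff, ← Equiv.symm_apply_eq, ← Equiv.symm_apply_eq]
      cases hb : (e.symm v).2
      · exact Or.inr (Prod.ext hv hb)
      · exact Or.inl (Prod.ext hv hb)
    · have : i ≠ k := fun h => hx (by simp [root, h])
      exact h (i + 1) (by omega) (by omega)
  refine csSup_le' ?_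
  rintro _ ⟨x, y, hxy, rfl⟩
  have hadj : (parentGraph parent).Adj x y := hxy
  obtain ⟨hne, h1 | h1⟩ := parentGraph_adj.1 hadj
  · subst h1
    exact key x (by rintro rfl; exact hne parent_root.symm)
  · subst h1
    rw [← (decomposition e).shore_compl hxy.symm, porosity_compl]
    exact key y (by rintro rfl; exact hne parent_root)

end PMWidth

/-! ### From an elimination ordering to a decomposition of width two -/

namespace PMWidth

variable {V : Type*} [Finite V] {G : SimpleGraph V} {A B : Set V}

/-- Two numberings of the colour classes are combined into the pairs `{β 0, β 1}`, then
`{α i, β (i + 2)}` for each `i ≤ k`, and finally `{α (k + 1), α (k + 2)}`. If `α i` is adjacent to no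
`β j` with `j > i + 2`, then a perfect matching crosses each initial segment of at least two and at
most `k + 1` pairs only with edges starting in `B`, hence at most twice. -/
lemma exists_width_le_two_of_numberings (hAB : G.IsBipartiteWith A B)
    (hcover : A ∪ B = Set.univ) {k : ℕ} (hk : Nat.card V = 2 * (k + 3)) {α β : Fin (k + 3) → V}
    (hα : Function.Injective α) (hβ : Function.Injective β) (hαA : ∀ i, α i ∈ A)
    (hβB : ∀ i, β i ∈ B) (hadj : ∀ i j, G.Adj (α i) (β j) → (j : ℕ) ≤ i + 2)
    (hβsurj : ∀ b ∈ B, ∃ j, β j = b) :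
    ∃ D : PMDecomposition V, D.width G ≤ 2 := by
  have hne : ∀ i j, α i ≠ β j := fun i j h =>
    Set.disjoint_left.1 hAB.disjoint (hαA i) (h ▸ hβB j)
  -- `F (i, false)` runs through `β 0, α 0, …, α (k + 1)`, and `F (i, true)` through
  -- `β 1, …, β (k + 2), α (k + 2)`
  let F : Fin (k + 3) × Bool → V := fun p =>
    if p.2 then (if h : (p.1 : ℕ) + 1 < k + 3 then β ⟨p.1 + 1, h⟩ else α ⟨k + 2, by omega⟩)
    else (if (p.1 : ℕ) = 0 then β ⟨0, by omega⟩ else α ⟨p.1 - 1, by omega⟩)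
  have hF1 : ∀ (i : Fin (k + 3)) (h : (i : ℕ) + 1 < k + 3), F (i, true) = β ⟨i + 1, h⟩ := fun i h => by
    simp only [F, if_true, dif_pos h]
  have hF2 : ∀ i : Fin (k + 3), ¬ ((i : ℕ) + 1 < k + 3) → F (i, true) = α ⟨k + 2, by omega⟩ :=
    fun i h => by simp only [F, if_true, dif_neg h]
  have hF3 : ∀ i : Fin (k + 3), (i : ℕ) = 0 → F (i, false) = β ⟨0, by omega⟩ := fun i h => by
    simp only [F, Bool.false_eq_true, if_false, if_pos h]
  have hF4 : ∀ i : Fin (k + 3), (i : ℕ) ≠ 0 → F (i, false) = α ⟨i - 1, by omega⟩ := fun i h => by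
    simp only [F, Bool.false_eq_true, if_false, if_neg h]
  have hFinj : Function.Injective F := by
    have hα' : ∀ i j, α i = α j → (i : ℕ) = j := fun i j h => congrArg Fin.val (hα h)
    have hβ' : ∀ i j, β i = β j → (i : ℕ) = j := fun i j h => congrArg Fin.val (hβ h)
    rintro ⟨i, b⟩ ⟨j, c⟩ h
    rw [Prod.mk.injEq, Fin.ext_iff]
    have hi := i.2
    have hj := j.2
    cases b <;> cases c
    · by_cases h1 : (i : ℕ) = 0 <;> by_cases h2 : (j : ℕ) = 0
      · exact ⟨h1.trans h2.symm, rfl⟩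
      · rw [hF3 i h1, hF4 j h2] at h; exact absurd h.symm (hne _ _)
      · rw [hF4 i h1, hF3 j h2] at h; exact absurd h (hne _ _)
      · rw [hF4 i h1, hF4 j h2] at h
        have := hα' _ _ h
        simp only at this
        exact ⟨by omega, rfl⟩
    · exfalso
      by_cases h1 : (i : ℕ) = 0 <;> by_cases h2 : (j : ℕ) + 1 < k + 3
      · rw [hF3 i h1, hF1 j h2] at h
        have := hβ' _ _ h
        simp only at this
        omega
      · rw [hF3 i h1, hF2 j h2] at h; exact hne _ _ h.symm
      · rw [hF4 i h1, hF1 j h2] at h; exact hne _ _ h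
      · rw [hF4 i h1, hF2 j h2] at h
        have := hα' _ _ h
        simp only at this
        omega
    · exfalso
      by_cases h1 : (j : ℕ) = 0 <;> by_cases h2 : (i : ℕ) + 1 < k + 3
      · rw [hF3 j h1, hF1 i h2] at h
        have := hβ' _ _ h
        simp only at this
        omega
      · rw [hF3 j h1, hF2 i h2] at h; exact hne _ _ h
      · rw [hF4 j h1, hF1 i h2] at h; exact hne _ _ h.symm
      · rw [hF4 j h1, hF2 i h2] at h
        have := hα' _ _ h
        simp only at this
        omega
    · by_cases h1 : (i : ℕ) + 1 < k + 3 <;> by_cases h2 : (j : ℕ) + 1 < k + 3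
      · rw [hF1 i h1, hF1 j h2] at h
        have := hβ' _ _ h
        simp only at this
        exact ⟨by omega, rfl⟩
      · rw [hF1 i h1, hF2 j h2] at h; exact absurd h.symm (hne _ _)
      · rw [hF2 i h1, hF1 j h2] at h; exact absurd h (hne _ _)
      · exact ⟨by omega, rfl⟩
  have hFbij : Function.Bijective F := by
    have : Fintype V := Fintype.ofFinite V
    rw [Fintype.bijective_iff_injective_and_card]
    refine ⟨hFinj, ?_⟩
    rw [← Nat.card_eq_fintype_card (α := V), hk]
    simp [mul_comm]
  let e : Fin (k + 3) × Bool ≃ V := Equiv.ofBijective F hFbij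
  have he : ∀ p, e.symm (F p) = p := fun p => e.symm_apply_apply p
  refine ⟨_, caterpillar_width_le e fun j hj1 hjk => ?_⟩
  rw [porosity_le_iff]
  intro f hf
  set X : Set V := {v | ((e.symm v).1 : ℕ) ≤ j} with hX
  have hmemX : ∀ p, F p ∈ X ↔ (p.1 : ℕ) ≤ j := fun p => by rw [hX, Set.mem_ofPred_eq, he]
  have hαX : ∀ i : Fin (k + 3), α i ∈ X ↔ (i : ℕ) < j := by
    intro i
    by_cases h : (i : ℕ) + 1 < k + 3
    · have := hmemX (⟨i + 1, h⟩, false)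
      rw [hF4 _ (by simp)] at this
      exact this
    · have := hmemX (i, true)
      rw [hF2 i h] at this
      have hi : i = ⟨k + 2, by omega⟩ := Fin.ext (by have := i.2; simp only; omega)
      rw [← hi] at this
      rw [this]
      simp only
      omega
  have hβX : ∀ i : Fin (k + 3), β i ∈ X ↔ (i : ℕ) ≤ j + 1 := by
    intro i
    by_cases h : (i : ℕ) = 0
    · have := hmemX (i, false)
      rw [hF3 i h] at this
      have hi : i = ⟨0, by omega⟩ := Fin.ext h
      rw [← hi] at this
      rw [this]
      simp only
      omega
    · obtain ⟨i, hi⟩ := i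
      obtain ⟨l, rfl⟩ : ∃ l, i = l + 1 := ⟨i - 1, by simp only at h; omega⟩
      have := hmemX (⟨l, by omega⟩, true)
      rw [hF1 ⟨l, by omega⟩ hi] at this
      exact this.trans (by simp)
  have hFv : ∀ v, ∃ i, α i = v ∨ β i = v := by
    intro v
    obtain ⟨⟨i, b⟩, rfl⟩ := hFbij.2 v
    cases b
    · by_cases h : (i : ℕ) = 0
      · exact ⟨_, Or.inr (hF3 i h).symm⟩
      · exact ⟨_, Or.inl (hF4 i h).symm⟩
    · by_cases h : (i : ℕ) + 1 < k + 3
      · exact ⟨_, Or.inr (hF1 i h).symm⟩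
      · exact ⟨_, Or.inl (hF2 i h).symm⟩
  have h0 : A ∩ crossing f X = ∅ := by
    ext v
    simp only [crossing, Set.mem_inter_iff, Set.mem_ofPred_eq, Set.mem_empty_iff_false, iff_false]
    rintro ⟨h1, h2, h3⟩
    obtain ⟨i, rfl | rfl⟩ := hFv v
    · obtain ⟨l, hl⟩ := hβsurj _ (mem_right_of_map hAB hf h1)
      have h4 := hf.2 (α i)
      rw [← hl] at h3 h4
      rw [hβX] at h3
      rw [hαX] at h2
      have := hadj i l h4
      omega
    · exact Set.disjoint_left.1 hAB.disjoint h1 (hβB i)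
  have hAX : j ≤ (A ∩ X).ncard := by
    have hsub : (fun i : Fin j => α ⟨i, by omega⟩) '' Set.univ ⊆ A ∩ X := by
      rintro _ ⟨i, -, rfl⟩
      exact ⟨hαA _, (hαX _).2 i.2⟩
    have := Set.ncard_le_ncard hsub
    rw [Set.ncard_image_of_injective _ fun x y h => Fin.ext (Fin.mk.inj (hα h)), Set.ncard_univ,
      Nat.card_fin] at this
    exact this
  have hBX : (B ∩ X).ncard ≤ j + 2 := by
    have hsub : B ∩ X ⊆ (fun i : Fin (j + 2) => β ⟨i, by omega⟩) '' Set.univ := by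
      rintro v ⟨hv1, hv2⟩
      obtain ⟨l, rfl⟩ := hβsurj v hv1
      exact ⟨⟨l, by have := (hβX l).1 hv2; omega⟩, trivial, rfl⟩
    have := (Set.ncard_le_ncard hsub).trans (Set.ncard_image_le)
    rwa [Set.ncard_univ, Nat.card_fin] at this
  have := crossing_count hAB hcover hf X
  rw [h0, Set.ncard_empty] at this
  omega

/-- The vertices of `B` can be numbered compatibly with a numbering of `A` in which initial
segments have at most two neighbours more than elements: sort them by their first neighbour. -/
lemma exists_sorted_numbering (hAB : G.IsBipartiteWith A B) {f : V → V} (hf : IsMatchingMap G f)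
    {m : ℕ} (hm : B.ncard = m) {α : Fin m → V} (hαA : ∀ a ∈ A, ∃ i, α i = a)
    (hα : ∀ i, (nbhd G {x | ∃ j ≤ i, x = α j}).ncard ≤ i + 3) :
    ∃ β : Fin m → V, Function.Injective β ∧ (∀ i, β i ∈ B) ∧ (∀ b ∈ B, ∃ j, β j = b) ∧
      ∀ i j, G.Adj (α i) (β j) → (j : ℕ) ≤ i + 2 := by
  classical
  obtain ⟨ε⟩ : Nonempty (Fin m ≃ B) := ⟨(Finite.equivFinOfCardEq hm).symm⟩
  have hex : ∀ j, ∃ i : ℕ, ∃ hi : i < m, G.Adj (α ⟨i, hi⟩) (ε j) := by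
    intro j
    obtain ⟨i, hi⟩ := hαA _ (mem_right_of_map hAB.symm hf (ε j).2)
    exact ⟨i, i.2, by rw [Fin.eta, hi]; exact (hf.2 _).symm⟩
  let h : Fin m → ℕ := fun j => Nat.find (hex j)
  let σ := Tuple.sort h
  have hmono : Monotone (h ∘ σ) := Tuple.monotone_sort h
  have hinj : Function.Injective fun j => (ε (σ j) : V) := fun x y hxy =>
    σ.injective (ε.injective (Subtype.ext hxy))
  refine ⟨fun j => ε (σ j), hinj, fun j => (ε (σ j)).2,
    fun b hb => ⟨σ.symm (ε.symm ⟨b, hb⟩), by simp⟩, fun i j hij => ?_⟩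
  -- the first `j + 1` vertices of `B` all have a neighbour among the first `i + 1` of `A`
  have hsub : (fun j => (ε (σ j) : V)) '' (Finset.Iic j : Finset (Fin m)) ⊆
      nbhd G {x | ∃ l ≤ i, x = α l} := by
    rintro _ ⟨l, hl, rfl⟩
    obtain ⟨hi, hadj⟩ := Nat.find_spec (hex (σ l))
    refine ⟨_, ⟨_, ?_, rfl⟩, hadj⟩
    have h1 : h (σ l) ≤ h (σ j) := hmono (by simpa using hl)
    exact h1.trans (Nat.find_min' (hex (σ j)) ⟨i.2, hij⟩)
  have h2 := (Set.ncard_le_ncard hsub).trans (hα i)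
  rw [Set.ncard_image_of_injective _ hinj, Set.ncard_coe_finset, Fin.card_Iic] at h2
  omega

omit [Finite V] in
lemma pred_eq_image (lam : Ordering A) (a : A) :
    pred lam a = (fun j => (lam.symm j : V)) '' (Finset.Iic (lam a) : Finset (Fin A.ncard)) := by
  ext x
  constructor
  · rintro ⟨a', h, rfl⟩
    exact ⟨lam a', by simpa using h, by simp⟩
  · rintro ⟨j, hj, rfl⟩
    exact ⟨lam.symm j, by simpa using hj, rfl⟩

omit [Finite V] in
lemma ncard_pred (lam : Ordering A) (a : A) : (pred lam a).ncard = lam a + 1 := by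
  rw [pred_eq_image, Set.ncard_image_of_injective _ fun x y h =>
    lam.symm.injective (Subtype.ext h),
    Set.ncard_coe_finset, Fin.card_Iic]

/-- From an elimination ordering to a decomposition of width two. -/
lemma exists_width_le_two_of_ordering (hAB : G.IsBipartiteWith A B) (hcover : A ∪ B = Set.univ)
    (hG : IsBrace G) (hcard : 6 ≤ Nat.card V) (lam : Ordering A)
    (hlam : ∀ a, (reach G lam a).ncard ≤ (pred lam a).ncard + 2) :
    ∃ D : PMDecomposition V, D.width G ≤ 2 := by
  have hn := ncard_colours_eq hAB hcover hG hcard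
  obtain ⟨f, hf⟩ := exists_matchingMap_of_brace hG hcard
  obtain ⟨k, hk⟩ : ∃ k, A.ncard = k + 3 := ⟨A.ncard - 3, by omega⟩
  let α : Fin (k + 3) → V := fun i => lam.symm (Fin.cast hk.symm i)
  have hα : Function.Injective α := fun x y h =>
    Fin.cast_injective _ (lam.symm.injective (Subtype.ext h))
  have hαA : ∀ a ∈ A, ∃ i, α i = a := fun a ha => ⟨Fin.cast hk (lam ⟨a, ha⟩), by simp [α]⟩
  obtain ⟨β, h1, h2, h3, h4⟩ := exists_sorted_numbering hAB hf (m := k + 3) (by omega) hαA (by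
    intro i
    have h := hlam (lam.symm (Fin.cast hk.symm i))
    rw [ncard_pred, Equiv.apply_symm_apply] at h
    have hp : pred lam (lam.symm (Fin.cast hk.symm i)) = {x | ∃ j ≤ i, x = α j} := by
      ext x
      constructor
      · rintro ⟨a', h, rfl⟩
        refine ⟨Fin.cast hk (lam a'), ?_, by simp [α]⟩
        rw [Equiv.apply_symm_apply] at h
        exact h
      · rintro ⟨j, hj, rfl⟩
        exact ⟨_, by simpa using hj, rfl⟩
    rw [← hp]
    exact h)
  exact exists_width_le_two_of_numberings hAB hcover (by omega) hα h1
    (fun i => (lam.symm (Fin.cast hk.symm i)).2) h2 h4 h3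

/-- The first vertex of any ordering has at least three neighbours. -/
lemma two_le_orderingWidth (hAB : G.IsBipartiteWith A B) (hcover : A ∪ B = Set.univ)
    (hG : IsBrace G) (hcard : 6 ≤ Nat.card V) (lam : Ordering A) : 2 ≤ orderingWidth G lam := by
  have hn := ncard_colours_eq hAB hcover hG hcard
  have ha := ncard_pred lam (lam.symm ⟨0, by omega⟩)
  rw [Equiv.apply_symm_apply] at ha
  have hsub : pred lam (lam.symm ⟨0, by omega⟩) ⊆ A := by
    rintro _ ⟨a, -, rfl⟩
    exact a.2
  have h1 := card_add_two_le_nbhd hAB hcover hG hcard hsub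
    (by rw [← Set.ncard_pos]; omega) (by simp only at ha; omega)
  have h2 : (pred lam (lam.symm ⟨0, by omega⟩)).ncard + 2 ≤
      (reach G lam (lam.symm ⟨0, by omega⟩)).ncard := h1
  refine le_trans ?_ (le_ciSup (Set.finite_range _).bddAbove (lam.symm ⟨0, by omega⟩))
  omega

lemma matchingEliminationWidth_eq_two_iff (hAB : G.IsBipartiteWith A B)
    (hcover : A ∪ B = Set.univ) (hG : IsBrace G) (hcard : 6 ≤ Nat.card V) :
    matchingEliminationWidth G A = 2 ↔
      ∃ lam : Ordering A, ∀ a, (reach G lam a).ncard ≤ (pred lam a).ncard + 2 := by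
  have hn := ncard_colours_eq hAB hcover hG hcard
  have : Nonempty (Ordering A) := ⟨Finite.equivFinOfCardEq rfl⟩
  have : Nonempty A := Set.nonempty_coe_sort.2 (by rw [← Set.ncard_pos]; omega)
  constructor
  · intro h
    obtain ⟨lam, hlam⟩ :=
      exists_eq_ciInf_of_finite (f := fun lam : Ordering A => orderingWidth G lam)
    have hlam' : orderingWidth G lam = 2 := hlam.trans h
    refine ⟨lam, fun a => ?_⟩
    have := le_ciSup (f := fun a : A => ((reach G lam a).ncard : ℤ) - ((pred lam a).ncard : ℤ))
      (Set.finite_range _).bddAbove a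
    have h2 : ((reach G lam a).ncard : ℤ) - ((pred lam a).ncard : ℤ) ≤ orderingWidth G lam := this
    omega
  · rintro ⟨lam, hlam⟩
    refine le_antisymm ?_ (le_ciInf fun lam => two_le_orderingWidth hAB hcover hG hcard lam)
    refine (ciInf_le (Set.finite_range _).bddBelow lam).trans (ciSup_le fun a => ?_)
    have := hlam a
    omega

lemma pmw_eq_two_iff (hAB : G.IsBipartiteWith A B) (hcover : A ∪ B = Set.univ) (hG : IsBrace G)
    (hcard : 6 ≤ Nat.card V) : pmw G = 2 ↔ ∃ D : PMDecomposition V, D.width G ≤ 2 := by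
  constructor
  · intro h
    have hne : {k | ∃ D : PMDecomposition V, k = D.width G}.Nonempty := by
      by_contra hem
      rw [Set.not_nonempty_iff_eq_empty] at hem
      rw [pmw, hem, Nat.sInf_empty] at h
      omega
    obtain ⟨D, hD⟩ := Nat.sInf_mem hne
    exact ⟨D, hD.symm.trans h |>.le⟩
  · rintro ⟨D, hD⟩
    have hne : {k | ∃ D : PMDecomposition V, k = D.width G}.Nonempty := ⟨_, D, rfl⟩
    have hle : pmw G ≤ D.width G := Nat.sInf_le ⟨D, rfl⟩
    refine le_antisymm (hle.trans hD) (le_csInf hne ?_)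
    rintro _ ⟨D, rfl⟩
    exact two_le_width hAB hcover hG hcard D

end PMWidth

theorem mainTheorem1 {V : Type*} [Finite V] (G : SimpleGraph V) (A B : Set V)
    (hAB : G.IsBipartiteWith A B) (hcover : A ∪ B = Set.univ)
    (hG : PMWidth.IsBrace G) (hcard : 6 ≤ Nat.card V) :
    PMWidth.pmw G = 2 ↔ PMWidth.matchingEliminationWidth G A = 2 := by
  rw [PMWidth.pmw_eq_two_iff hAB hcover hG hcard,
    PMWidth.matchingEliminationWidth_eq_two_iff hAB hcover hG hcard]
  constructor
  · rintro ⟨D, hD⟩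
    exact PMWidth.exists_ordering_of_width_le_two hAB hcover hG hcard hD
  · rintro ⟨lam, hlam⟩
    exact PMWidth.exists_width_le_two_of_ordering hAB hcover hG hcard lam hlam
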